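/- Let $K$ be a field of characteristic $0$ and let $R$ be an integral domain which is a regular ring and a localisation of a finitely generated $K$-algebra. Assume that $R$ has a maximal ideal $\mathfrak m$ such that $R/\mathfrak m$ is a finite extension of $K$. **Definitions.** Let $G=R[d^{(k)}r \mid k\ge 1,\ r\in R]$ be the polynomial algebra, graded by $\deg d^{(k)}r=k$, put $d^{(0)}r=r$, and let $I$ be the homogeneous ideal generated by all $d^{(k)}(r+s)-d^{(k)}r-d^{(k)}s$, all $d^{(k)}a$ with $a\in K$, and all $d^{(k)}(rs)-\sum_{i+j=k}d^{(i)}r\,d^{(j)}s$ ($k\ge1$; $r,s\in R$). Let $\mathrm{Dif}=\mathrm{Dif}_{R/K}=\prod_k (G/I)_k$ be the completion of $G/I$, let $d_R\colon R\to\mathrm{Dif}$, $r\mapsto\sum_k d^{(k)}r$, and let $d_{\mathrm{Dif}}\colon\mathrm{Dif}\to\mathrm{Dif}$ be the continuous ring homomorphism with $d_{\mathrm{Dif}}(d^{(i)}r)=\sum_j\binom{i+j}{j}d^{(i+j)}r$. There is a canonical isomorphism $\mathrm{Dif}_1\cong\Omega_{R/K}$, $d^{(1)}r\mapsto dr$.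 For a finitely generated $R$-module $M$ write $\mathrm{Dif}\otimes_R M=\prod_k \mathrm{Dif}_k\otimes_R M$. A *higher connection* on $M$ is an additive map $\nabla=\sum_k\nabla^{(k)}\colon M\to\mathrm{Dif}\otimes_R M$ with $\nabla^{(0)}(m)=1\otimes m$ and $\nabla(rm)=d_R(r)\nabla(m)$. It extends to ${}_{\mathrm{Dif}}\nabla\colon\mathrm{Dif}\otimes_R M\to\mathrm{Dif}\otimes_R M$, $\omega\otimes x\mapsto d_{\mathrm{Dif}}(\omega)\cdot\nabla(x)$; let ${}_{\mathrm{Dif}}\nabla^{(i)}$ be the part of ${}_{\mathrm{Dif}}\nabla$ that raises degrees by $i$. $\nabla$ is *iterative* if ${}_{\mathrm{Dif}}\nabla^{(i)}\circ{}_{\mathrm{Dif}}\nabla^{(j)}=\binom{i+j}{i}{}_{\mathrm{Dif}}\nabla^{(i+j)}$ for all $i,j\ge 0$. Let $\mathrm{HD}_K(R)$ be the set of $K$-algebra homomorphisms $\psi\colon R\to R[[T]]$ with $\psi\equiv\mathrm{id}\bmod T$, with the product $\psi_1\psi_2=\psi_1[[T]]\circ\psi_2$, where $\psi[[T]](\sum_i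 a_iT^i)=\sum_i\psi(a_i)T^i$. For $\psi=\sum_k\psi^{(k)}T^k\in\mathrm{HD}_K(R)$ let $\tilde\psi\colon\mathrm{Dif}\to R[[T]]$ be the continuous $R$-algebra homomorphism with $\tilde\psi(d^{(k)}r)=\psi^{(k)}(r)T^k$, and put $\nabla_\psi=(\tilde\psi\otimes\mathrm{id})\circ\nabla\colon M\to M[[T]]$. An iterative connection is *integrable* if $\nabla_{\psi_1\psi_2}=\nabla_{\psi_1}[[T]]\circ\nabla_{\psi_2}$ for all $\psi_1,\psi_2\in\mathrm{HD}_K(R)$, where $\nabla_{\psi}[[T]](\sum_i m_iT^i)=\sum_i\nabla_\psi(m_i)T^i$. A *connection* on $M$ is an additive map $\nabla\colon M\to\Omega_{R/K}\otimes_R M$ with $\nabla(rm)=r\nabla(m)+dr\otimes m$; it is *integrable* if $\nabla_{[\partial_1,\partial_2]}=[\nabla_{\partial_1},\nabla_{\partial_2}]$ for all $\partial_1,\partial_2\in\mathrm{Der}(R/K)$. In all categories below the objects are finitely generated $R$-modules with the structure indicated, and the morphisms are the $R$-linear maps $f$ with $(\mathrm{id}\otimes f)\circ\nabla_1=\nabla_2\circ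 f$. **Theorem.** 1. For every finitely generated $R$-module $M$, the map $\nabla\mapsto\nabla^{(1)}$ (with $\mathrm{Dif}_1\cong\Omega_{R/K}$) is a bijection from the iterative connections on $M$ to the connections on $M$, and an iterative connection $\nabla$ is integrable if and only if the connection $\nabla^{(1)}$ is integrable. 2. The functor $(M,\nabla)\mapsto(M,\nabla^{(1)})$, $f\mapsto f$, is an equivalence from the category $\mathbf{ICon}(R/K)$ of modules with iterative connection to the category of modules with connection, and it restricts to an equivalence from the category $\mathbf{ICon}_{\mathbf{int}}(R/K)$ of modules with integrable iterative connection to the category of modules with integrable connection. -/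

import Mathlib

open scoped TensorProduct
open CategoryTheory Finset.HasAntidiagonal

universe w u v

noncomputable section

namespace IterConn

section Differentials

variable (K : Type w) (R : Type u) [Field K] [CommRing R] [Algebra K R]

/-! ### The algebra of higher differentials -/

/-- The symbol `d^{(k)} r` in the polynomial algebra `G = R[d^{(k)} r | k ≥ 1, r ∈ R]`, with
`d^{(0)} r = r`.  The variable indexed by `(n, r)` is the symbol `d^{(n+1)} r`. -/
def sym : ℕ → R → MvPolynomial (ℕ × R) R
  | 0, r => MvPolynomial.C r
  | n + 1, r => MvPolynomial.X (n, r)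

/-- The ideal of relations: additivity, vanishing on constants, and the Leibniz rules. -/
def relIdeal : Ideal (MvPolynomial (ℕ × R) R) :=
  Ideal.span
    ({p | ∃ (k : ℕ) (r s : R), 1 ≤ k ∧ p = sym R k (r + s) - sym R k r - sym R k s} ∪
     {p | ∃ (k : ℕ) (a : K), 1 ≤ k ∧ p = sym R k (algebraMap K R a)} ∪
     {p | ∃ (k : ℕ) (r s : R), 1 ≤ k ∧
        p = sym R k (r * s) - ∑ ij ∈ antidiagonal k, sym R ij.1 r * sym R ij.2 s})

/-- The graded algebra `G / I` of higher differentials of `R` over `K`.  The complete algebra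
`Dif_{R/K}` is the product `∏ₖ (Dif_{R/K})ₖ` of its homogeneous components, see `DifGr.comp`. -/
def DifGr : Type u := MvPolynomial (ℕ × R) R ⧸ relIdeal K R

instance : CommRing (DifGr K R) :=
  inferInstanceAs (CommRing (MvPolynomial (ℕ × R) R ⧸ relIdeal K R))

instance : Algebra R (DifGr K R) :=
  inferInstanceAs (Algebra R (MvPolynomial (ℕ × R) R ⧸ relIdeal K R))

instance : Algebra K (DifGr K R) :=
  inferInstanceAs (Algebra K (MvPolynomial (ℕ × R) R ⧸ relIdeal K R))

instance : IsScalarTower K R (DifGr K R) :=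
  inferInstanceAs (IsScalarTower K R (MvPolynomial (ℕ × R) R ⧸ relIdeal K R))

namespace DifGr

/-- The residue class map `G → G / I`. -/
def mk : MvPolynomial (ℕ × R) R →ₐ[R] DifGr K R := Ideal.Quotient.mkₐ R (relIdeal K R)

/-- The components `d^{(k)} : R → (Dif_{R/K})ₖ` of the universal higher derivation. -/
def d (k : ℕ) (r : R) : DifGr K R := mk K R (sym R k r)

/-- The homogeneous component `(Dif_{R/K})ₖ`: classes of polynomials that are weighted homogeneous
of degree `k`, where the variable `d^{(n)} r` has degree `n`. -/
def comp (k : ℕ) : Submodule R (DifGr K R) :=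
  (MvPolynomial.weightedHomogeneousSubmodule R (fun i : ℕ × R => i.1 + 1) k).map
    (mk K R).toLinearMap

variable {R}

theorem mk_eq_zero {p : MvPolynomial (ℕ × R) R} (hp : p ∈ relIdeal K R) : mk K R p = 0 :=
  (Ideal.Quotient.eq_zero_iff_mem).2 hp

theorem d_zero (r : R) : d K R 0 r = algebraMap R (DifGr K R) r := rfl

theorem d_add (k : ℕ) (r s : R) : d K R k (r + s) = d K R k r + d K R k s := by
  rcases k with _ | k
  · simp [d_zero]
  · have : sym R (k + 1) (r + s) - sym R (k + 1) r - sym R (k + 1) s ∈ relIdeal K R :=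
      Ideal.subset_span (Or.inl (Or.inl ⟨k + 1, r, s, by omega, rfl⟩))
    have h := mk_eq_zero K this
    rw [map_sub, map_sub, sub_sub, sub_eq_zero] at h
    exact h

theorem d_algebraMap (k : ℕ) (hk : 1 ≤ k) (a : K) : d K R k (algebraMap K R a) = 0 :=
  mk_eq_zero K
    (Ideal.subset_span (Or.inl (Or.inr ⟨k, a, hk, rfl⟩)))

theorem d_mul (k : ℕ) (r s : R) :
    d K R k (r * s) = ∑ ij ∈ antidiagonal k, d K R ij.1 r * d K R ij.2 s := by
  rcases k with _ | k
  · simp [d_zero]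
  · have : sym R (k + 1) (r * s) -
        ∑ ij ∈ antidiagonal (k + 1), sym R ij.1 r * sym R ij.2 s ∈ relIdeal K R :=
      Ideal.subset_span (Or.inr ⟨k + 1, r, s, by omega, rfl⟩)
    have h := mk_eq_zero K this
    rw [map_sub, sub_eq_zero, map_sum] at h
    exact h.trans (Finset.sum_congr rfl fun ij _ => map_mul _ _ _)

theorem d_one (k : ℕ) : d K R k 1 = if k = 0 then 1 else 0 := by
  rcases k with _ | k
  · simp [d_zero]
  · simpa using d_algebraMap (R := R) K (k + 1) (by omega) 1

/-- A ring homomorphism out of the graded algebra of higher differentials is given by a ring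
homomorphism `φ` on `R` and by images `g k r` of the `d^{(k)} r` that satisfy the relations. -/
def lift {B : Type*} [CommRing B] (φ : R →+* B) (g : ℕ → R → B) (g_zero : ∀ r, g 0 r = φ r)
    (g_add : ∀ k r s, 1 ≤ k → g k (r + s) = g k r + g k s)
    (g_const : ∀ k (a : K), 1 ≤ k → g k (algebraMap K R a) = 0)
    (g_mul : ∀ k r s, 1 ≤ k → g k (r * s) = ∑ ij ∈ antidiagonal k, g ij.1 r * g ij.2 s) :
    DifGr K R →+* B :=
  Ideal.Quotient.lift (relIdeal K R) (MvPolynomial.eval₂Hom φ (fun i => g (i.1 + 1) i.2)) (by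
    have key : ∀ k r,
        MvPolynomial.eval₂Hom φ (fun i : ℕ × R => g (i.1 + 1) i.2) (sym R k r) = g k r := by
      intro k r
      rcases k with _ | k
      · simp [sym, g_zero]
      · simp [sym]
    intro a ha
    have hle : relIdeal K R ≤
        RingHom.ker (MvPolynomial.eval₂Hom φ (fun i : ℕ × R => g (i.1 + 1) i.2)) := by
      refine Ideal.span_le.2 ?_
      rintro p ((⟨k, r, s, hk, rfl⟩ | ⟨k, a, hk, rfl⟩) | ⟨k, r, s, hk, rfl⟩)
      · simp only [SetLike.mem_coe, RingHom.mem_ker, map_sub, key, g_add k r s hk]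
        ring
      · simp only [SetLike.mem_coe, RingHom.mem_ker, key, g_const k a hk]
      · simp only [SetLike.mem_coe, RingHom.mem_ker, map_sub, map_sum, map_mul, key,
          g_mul k r s hk, sub_self]
    exact hle ha)

theorem lift_d {B : Type*} [CommRing B] (φ : R →+* B) (g : ℕ → R → B) (h₀ h₁ h₂ h₃)
    (k : ℕ) (r : R) : lift K φ g h₀ h₁ h₂ h₃ (d K R k r) = g k r := by
  rcases k with _ | k
  · exact (MvPolynomial.eval₂Hom_C _ _ _).trans (h₀ r).symm
  · exact MvPolynomial.eval₂Hom_X' _ _ _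

/-- The universal higher derivation as a ring homomorphism `R → (G / I)⟦T⟧`,
`r ↦ ∑ₖ d^{(k)} r Tᵏ`. -/
def dHom : R →+* PowerSeries (DifGr K R) where
  toFun r := PowerSeries.mk fun k => d K R k r
  map_one' := by ext k; simp [d_one, PowerSeries.coeff_one]
  map_zero' := by
    ext k
    have h := d_add K k (0 : R) 0
    simpa using h
  map_mul' r s := by ext k; simp [d_mul, PowerSeries.coeff_mul]
  map_add' r s := by ext k; simp [d_add]

theorem choose_leibniz (k j : ℕ) (r s : R) :
    ((k + j).choose j : DifGr K R) * d K R (k + j) (r * s) =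
      ∑ pq ∈ antidiagonal k, ∑ ab ∈ antidiagonal j,
        (((pq.1 + ab.1).choose ab.1 : DifGr K R) * d K R (pq.1 + ab.1) r) *
        (((pq.2 + ab.2).choose ab.2 : DifGr K R) * d K R (pq.2 + ab.2) s) := by
  have inner : ∀ pq ∈ antidiagonal k,
      ∑ ab ∈ antidiagonal j,
        (((pq.1 + ab.1).choose ab.1 : DifGr K R) * d K R (pq.1 + ab.1) r) *
        (((pq.2 + ab.2).choose ab.2 : DifGr K R) * d K R (pq.2 + ab.2) s) =
      ∑ uv ∈ antidiagonal (k + j),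
        ((uv.1.choose pq.1 * uv.2.choose pq.2 : ℕ) : DifGr K R) *
          (d K R uv.1 r * d K R uv.2 s) := by
    rintro ⟨p, q⟩ hpq
    rw [mem_antidiagonal] at hpq
    dsimp only at hpq ⊢
    have hinj : Function.Injective (fun ab : ℕ × ℕ => (p + ab.1, q + ab.2)) := by
      rintro ⟨a, b⟩ ⟨a', b'⟩ h
      simp only [Prod.mk.injEq] at h ⊢
      omega
    have hsub : (antidiagonal j).map ⟨_, hinj⟩ ⊆ antidiagonal (k + j) := by
      rintro ⟨u, v⟩ h
      simp only [Finset.mem_map, mem_antidiagonal, Function.Embedding.coeFn_mk, Prod.mk.injEq,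
        Prod.exists] at h ⊢
      omega
    rw [← Finset.sum_subset hsub, Finset.sum_map]
    · refine Finset.sum_congr rfl ?_
      rintro ⟨a, b⟩ -
      simp only [Function.Embedding.coeFn_mk]
      rw [Nat.choose_symm_add (a := p) (b := a), Nat.choose_symm_add (a := q) (b := b)]
      push_cast
      ring
    · rintro ⟨x, y⟩ hxy hnot
      simp only [Finset.mem_map, mem_antidiagonal, Function.Embedding.coeFn_mk, Prod.mk.injEq,
        Prod.exists] at hxy hnot
      have : x < p ∨ y < q := by
        by_contra hcon
        push Not at hcon
        exact hnot ⟨x - p, y - q, by omega, by omega, by omega⟩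
      rcases this with h | h
      · simp [Nat.choose_eq_zero_of_lt h]
      · simp [Nat.choose_eq_zero_of_lt h]
  rw [Finset.sum_congr rfl inner, Finset.sum_comm, d_mul, Finset.mul_sum]
  refine Finset.sum_congr rfl ?_
  rintro ⟨x, y⟩ hxy
  rw [mem_antidiagonal] at hxy
  dsimp only at hxy ⊢
  rw [← Finset.sum_mul, ← Nat.choose_symm_add, ← hxy, Nat.add_choose_eq, Nat.cast_sum]

/-- The extension `d_Dif` of the universal higher derivation to the higher differentials, given by
`d_Dif (d^{(i)} r) = ∑ⱼ (i+j choose j) d^{(i+j)} r`.  The exponent of `T` records by how much the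
degree is raised, so that `d_Dif^{(j)}` is the coefficient of `Tʲ`. -/
def dDif : DifGr K R →+* PowerSeries (DifGr K R) :=
  lift K (dHom K)
    (fun i r => PowerSeries.mk fun j => ((i + j).choose j : DifGr K R) * d K R (i + j) r)
    (fun r => by ext j; simp [dHom])
    (fun k r s _ => by ext j; simp [d_add, mul_add])
    (fun k a hk => by ext j; simp [d_algebraMap K (R := R) (k + j) (by omega) a])
    (fun k r s _ => by
      ext j
      simp only [PowerSeries.coeff_mk, map_sum, PowerSeries.coeff_mul]
      exact choose_leibniz K k j r s)

/-- The homogeneous component `d_Dif^{(j)}`, which maps `(Dif_{R/K})ᵢ` to `(Dif_{R/K})ᵢ₊ⱼ`. -/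
def dDifComp (j : ℕ) : DifGr K R →+ DifGr K R :=
  (PowerSeries.coeff (R := DifGr K R) j).toAddMonoidHom.comp (dDif K (R := R)).toAddMonoidHom

theorem dDifComp_d (j i : ℕ) (r : R) :
    dDifComp K j (d K R i r) = ((i + j).choose j : DifGr K R) * d K R (i + j) r := by
  simp [dDifComp, dDif, lift_d]

theorem dDifComp_mul (j : ℕ) (x y : DifGr K R) :
    dDifComp K j (x * y) = ∑ ab ∈ antidiagonal j, dDifComp K ab.1 x * dDifComp K ab.2 y := by
  simp [dDifComp, PowerSeries.coeff_mul]

theorem dDifComp_algebraMap (j : ℕ) (r : R) :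
    dDifComp K j (algebraMap R (DifGr K R) r) = d K R j r := by
  rw [← d_zero, dDifComp_d]
  simp

/-- The right action of `R` on `Ω_{R/K}`, equal to the left action. -/
abbrev kaehlerOp : Module Rᵐᵒᵖ (Ω[R⁄K]) :=
  Module.compHom _ ((RingHom.id R).fromOpposite fun _ _ => mul_comm _ _)

attribute [local instance] kaehlerOp

theorem kaehlerCentral : IsCentralScalar R (Ω[R⁄K]) := ⟨fun _ _ => rfl⟩

attribute [local instance] kaehlerCentral

/-- The images of the `d^{(k)} r` in the square-zero extension `R ⊕ Ω_{R/K}`. -/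
def sqZeroVal : ℕ → R → TrivSqZeroExt R (Ω[R⁄K])
  | 0, r => TrivSqZeroExt.inl r
  | 1, r => TrivSqZeroExt.inr (KaehlerDifferential.D K R r)
  | _ + 2, _ => 0

/-- The homomorphism to the square-zero extension `R ⊕ Ω_{R/K}` that maps `d^{(1)} r` to the
differential of `r` and `d^{(k)} r` to `0` for `k ≥ 2`. -/
def toSqZero : DifGr K R →+* TrivSqZeroExt R (Ω[R⁄K]) :=
  lift K (TrivSqZeroExt.inlHom R (Ω[R⁄K])) (sqZeroVal K)
    (fun r => rfl)
    (fun k r s hk => by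
      match k, hk with
      | 1, _ => simp [sqZeroVal]
      | _ + 2, _ => simp [sqZeroVal])
    (fun k a hk => by
      match k, hk with
      | 1, _ => simp [sqZeroVal]
      | _ + 2, _ => simp [sqZeroVal])
    (fun k r s hk => by
      match k, hk with
      | 1, _ =>
        ext
        · simp [Finset.Nat.antidiagonal_succ, sqZeroVal]
        · simp [Finset.Nat.antidiagonal_succ, sqZeroVal]
      | k + 2, _ =>
        refine Eq.trans (b := 0) rfl (Finset.sum_eq_zero ?_).symm
        rintro ⟨i, j⟩ hij
        rw [mem_antidiagonal] at hij
        match i, j, hij with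
        | 0, 0, h => simp at h
        | 0, 1, h => simp at h
        | 1, 0, h => simp at h
        | 1, 1, h => simp [sqZeroVal]
        | _ + 2, _, h => simp [sqZeroVal]
        | _, _ + 2, h => simp [sqZeroVal])

/-- The projection of higher differentials to `Ω_{R/K}`, given by `d^{(1)} r ↦ d r` on the
component of degree one.  Its restriction to `(Dif_{R/K})₁` is the canonical isomorphism
`(Dif_{R/K})₁ ≃ Ω_{R/K}`, see `difOneEquiv`. -/
def toKaehler : DifGr K R →ₗ[R] Ω[R⁄K] where
  toFun x := (toSqZero K x).snd
  map_add' x y := by simp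
  map_smul' r x := by
    have h : toSqZero K (algebraMap R (DifGr K R) r) = TrivSqZeroExt.inl r := by
      rw [← d_zero]
      exact lift_d K _ _ _ _ _ _ 0 r
    simp [Algebra.smul_def, h]

theorem toKaehler_d_one (r : R) : toKaehler K (d K R 1 r) = KaehlerDifferential.D K R r :=
  congrArg TrivSqZeroExt.snd (lift_d K _ _ _ _ _ _ 1 r)

theorem d_one_mem (r : R) : d K R 1 r ∈ comp K R 1 :=
  Submodule.mem_map.2 ⟨MvPolynomial.X (0, r), MvPolynomial.isWeightedHomogeneous_X R _ _, rfl⟩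

/-- `d^{(1)}` as a derivation to the algebra of higher differentials. -/
def dOne : Derivation K R (DifGr K R) :=
  Derivation.mk'
    { toFun := d K R 1
      map_add' := d_add K 1
      map_smul' := fun a r => by
        have h : d K R 0 (algebraMap K R a) = algebraMap K (DifGr K R) a := rfl
        simp [Algebra.smul_def, d_mul, Finset.Nat.antidiagonal_succ, d_algebraMap, h] }
    (fun r s => by
      simp [d_mul, Finset.Nat.antidiagonal_succ, d_zero, Algebra.smul_def, mul_comm])

theorem dOne_apply (r : R) : dOne K r = d K R 1 r := rfl

theorem toKaehler_lift (x : Ω[R⁄K]) :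
    toKaehler K ((dOne K (R := R)).liftKaehlerDifferential x) = x := by
  have h2 : (toKaehler K (R := R)) ∘ₗ (dOne K (R := R)).liftKaehlerDifferential =
      LinearMap.id := by
    apply Derivation.liftKaehlerDifferential_unique
    ext r
    simp [dOne_apply, toKaehler_d_one]
  exact LinearMap.congr_fun h2 x

theorem comp_one_le : comp K R 1 ≤ Submodule.span R (Set.range (d K R 1)) := by
  rintro _ ⟨p, hp, rfl⟩
  have hp' : MvPolynomial.IsWeightedHomogeneous (fun i : ℕ × R => i.1 + 1) p 1 := hp
  rw [p.as_sum, map_sum]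
  refine Submodule.sum_mem _ fun m hm => ?_
  have hw := hp' (MvPolynomial.mem_support_iff.1 hm)
  obtain ⟨r, rfl⟩ : ∃ r : R, m = Finsupp.single (0, r) 1 := by
    rw [Finsupp.weight_apply, Finsupp.sum] at hw
    have hne : m.support.Nonempty := by
      rw [Finset.nonempty_iff_ne_empty]
      intro h
      simp [h] at hw
    obtain ⟨⟨n, r⟩, hi⟩ := hne
    have h1 := Finset.single_le_sum (f := fun i => m i • (i.1 + 1)) (fun _ _ => Nat.zero_le _) hi
    have hmi : 1 ≤ m (n, r) := Nat.one_le_iff_ne_zero.2 (Finsupp.mem_support_iff.1 hi)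
    dsimp only at h1
    rw [hw, smul_eq_mul] at h1
    have hn : n = 0 := by nlinarith
    subst hn
    have hm1 : m (0, r) = 1 := by omega
    refine ⟨r, Finsupp.ext fun j => ?_⟩
    by_cases hj : j = (0, r)
    · subst hj
      simp [hm1]
    · rw [Finsupp.single_eq_of_ne hj]
      by_contra hcon
      have hjm : j ∈ m.support := Finsupp.mem_support_iff.2 hcon
      have h2 := Finset.add_le_sum (f := fun i => m i • (i.1 + 1)) (fun _ _ => Nat.zero_le _)
        hi hjm (Ne.symm hj)
      dsimp only at h2
      rw [hw, hm1, smul_eq_mul, smul_eq_mul] at h2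
      have : 1 ≤ m j * (j.1 + 1) := Nat.mul_pos (Nat.pos_of_ne_zero hcon) (Nat.succ_pos _)
      omega
  have : (mk K R).toLinearMap (MvPolynomial.monomial (Finsupp.single ((0, r) : ℕ × R) 1)
      (MvPolynomial.coeff (Finsupp.single ((0, r) : ℕ × R) 1) p)) =
      MvPolynomial.coeff (Finsupp.single ((0, r) : ℕ × R) 1) p • d K R 1 r := by
    rw [d, sym, AlgHom.toLinearMap_apply, ← map_smul, MvPolynomial.X,
      MvPolynomial.smul_monomial, smul_eq_mul, mul_one]
  rw [this]
  exact Submodule.smul_mem _ _ (Submodule.subset_span ⟨r, rfl⟩)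

theorem lift_mem (x : Ω[R⁄K]) : (dOne K (R := R)).liftKaehlerDifferential x ∈ comp K R 1 := by
  have hx : x ∈ Submodule.span R (Set.range (KaehlerDifferential.D K R)) := by
    rw [KaehlerDifferential.span_range_derivation]
    trivial
  induction hx using Submodule.span_induction with
  | mem y hy =>
    obtain ⟨r, rfl⟩ := hy
    rw [Derivation.liftKaehlerDifferential_comp_D]
    exact d_one_mem K r
  | zero => simp
  | add y z _ _ hy hz => rw [map_add]; exact add_mem hy hz
  | smul r y _ hy => rw [map_smul]; exact Submodule.smul_mem _ _ hy

theorem lift_toKaehler {x : DifGr K R} (hx : x ∈ comp K R 1) :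
    (dOne K (R := R)).liftKaehlerDifferential (toKaehler K x) = x := by
  induction comp_one_le K hx using Submodule.span_induction with
  | mem y hy =>
    obtain ⟨r, rfl⟩ := hy
    rw [toKaehler_d_one, Derivation.liftKaehlerDifferential_comp_D, dOne_apply]
  | zero => simp
  | add y z hy' hz' hy hz =>
    have hle : Submodule.span R (Set.range (d K R 1)) ≤ comp K R 1 :=
      Submodule.span_le.2 (by rintro _ ⟨r, rfl⟩; exact d_one_mem K r)
    rw [map_add, map_add, hy (hle hy'), hz (hle hz')]
  | smul r y hy' hy =>
    have hle : Submodule.span R (Set.range (d K R 1)) ≤ comp K R 1 :=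
      Submodule.span_le.2 (by rintro _ ⟨r, rfl⟩; exact d_one_mem K r)
    rw [map_smul, map_smul, hy (hle hy')]

/-- The canonical isomorphism `(Dif_{R/K})₁ ≃ Ω_{R/K}`. -/
def difOneEquiv : comp K R 1 ≃ₗ[R] Ω[R⁄K] :=
  LinearEquiv.ofLinearMap ((toKaehler K).domRestrict (comp K R 1))
    ((dOne K).liftKaehlerDifferential.codRestrict (comp K R 1) (lift_mem K))
    (by ext x; simp [dOne_apply, toKaehler_d_one])
    (by ext x; simp [lift_toKaehler K x.2])

end DifGr

end Differentials

section HigherDerivations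

variable (K : Type w) (R : Type u) [Field K] [CommRing R] [Algebra K R]

/-! ### Higher derivations on `R` -/

/-- `HD_K(R)`: homomorphisms of `K`-algebras `ψ : R → R⟦T⟧` with `ε ∘ ψ = id`. -/
structure HigherDer where
  /-- The underlying homomorphism of `K`-algebras. -/
  toAlgHom : R →ₐ[K] PowerSeries R
  constantCoeff_apply : ∀ r, PowerSeries.constantCoeff (toAlgHom r) = r

namespace HigherDer

variable {K R} (ψ : HigherDer K R)

/-- The component `ψ^{(k)} : R → R`. -/
def coeff (k : ℕ) (r : R) : R := PowerSeries.coeff k (ψ.toAlgHom r)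

theorem coeff_zero (r : R) : ψ.coeff 0 r = r := by
  simpa [coeff] using ψ.constantCoeff_apply r

theorem coeff_add (k : ℕ) (r s : R) : ψ.coeff k (r + s) = ψ.coeff k r + ψ.coeff k s := by
  simp [coeff]

theorem coeff_sum {ι : Type*} (k : ℕ) (t : Finset ι) (f : ι → R) :
    ψ.coeff k (∑ i ∈ t, f i) = ∑ i ∈ t, ψ.coeff k (f i) := by
  simp [coeff]

theorem coeff_mul (k : ℕ) (r s : R) :
    ψ.coeff k (r * s) = ∑ ij ∈ antidiagonal k, ψ.coeff ij.1 r * ψ.coeff ij.2 s := by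
  simp [coeff, PowerSeries.coeff_mul]

theorem coeff_algebraMap (k : ℕ) (a : K) :
    ψ.coeff k (algebraMap K R a) = if k = 0 then algebraMap K R a else 0 := by
  rw [coeff, AlgHom.commutes, PowerSeries.algebraMap_apply, PowerSeries.coeff_C]

/-- The homomorphism `ψ̃`, as a homomorphism of rings. -/
def tildeHom : DifGr K R →+* PowerSeries R :=
  DifGr.lift K (PowerSeries.C (R := R))
    (fun k r => PowerSeries.monomial k (ψ.coeff k r))
    (fun r => by simp [ψ.coeff_zero])
    (fun k r s _ => by rw [coeff_add, map_add])
    (fun k a hk => by rw [coeff_algebraMap, if_neg (by omega), map_zero])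
    (fun k r s _ => by
      rw [coeff_mul, map_sum]
      refine Finset.sum_congr rfl fun ij hij => ?_
      rw [PowerSeries.monomial_mul_monomial, mem_antidiagonal.1 hij])

theorem tildeHom_d (k : ℕ) (r : R) :
    ψ.tildeHom (DifGr.d K R k r) = PowerSeries.monomial k (ψ.coeff k r) :=
  DifGr.lift_d K _ _ _ _ _ _ k r

/-- The homomorphism `ψ̃ : Dif_{R/K} → R⟦T⟧` with `ψ̃ ∘ d_R = ψ` that corresponds to `ψ` by the
universal property of the higher differentials: `ψ̃ (d^{(k)} r) = ψ^{(k)}(r) Tᵏ`. -/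
def tilde : DifGr K R →ₐ[R] PowerSeries R where
  toRingHom := ψ.tildeHom
  commutes' r := by
    change ψ.tildeHom (algebraMap R (DifGr K R) r) = _
    rw [← DifGr.d_zero, tildeHom_d, ψ.coeff_zero, PowerSeries.monomial_zero_eq_C_apply,
      PowerSeries.algebraMap_apply, Algebra.algebraMap_self_apply]

theorem tilde_d (k : ℕ) (r : R) :
    ψ.tilde (DifGr.d K R k r) = PowerSeries.monomial k (ψ.coeff k r) :=
  ψ.tildeHom_d k r

/-- The coefficient of `Tⁿ` in `ψ⟦T⟧ (∑ⱼ aⱼ Tʲ) = ∑ⱼ ψ(aⱼ) Tʲ`. -/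
def extendCoeff (f : PowerSeries R) (n : ℕ) : R :=
  ∑ ij ∈ antidiagonal n, ψ.coeff ij.1 (PowerSeries.coeff ij.2 f)

theorem extendCoeff_mul (f g : PowerSeries R) (n : ℕ) :
    ψ.extendCoeff (f * g) n =
      ∑ uv ∈ antidiagonal n, ψ.extendCoeff f uv.1 * ψ.extendCoeff g uv.2 := by
  simp only [extendCoeff, PowerSeries.coeff_mul, coeff_sum, coeff_mul, Finset.sum_mul_sum]
  simp only [Finset.sum_sigma']
  refine Finset.sum_nbij'
    (fun x => ⟨(x.2.2.1 + x.2.1.1, x.2.2.2 + x.2.1.2), (x.2.2.1, x.2.1.1), (x.2.2.2, x.2.1.2)⟩)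
    (fun y => ⟨(y.2.1.1 + y.2.2.1, y.2.1.2 + y.2.2.2), (y.2.1.2, y.2.2.2), (y.2.1.1, y.2.2.1)⟩)
    ?_ ?_ ?_ ?_ ?_
  · rintro ⟨⟨a, b⟩, ⟨p, q⟩, ⟨s, t⟩⟩ h
    simp only [Finset.mem_sigma, mem_antidiagonal] at h ⊢
    refine ⟨?_, ?_⟩ <;> grind
  · rintro ⟨⟨a, b⟩, ⟨p, q⟩, ⟨s, t⟩⟩ h
    simp only [Finset.mem_sigma, mem_antidiagonal] at h ⊢
    refine ⟨?_, ?_⟩ <;> grind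
  · rintro ⟨⟨a, b⟩, ⟨p, q⟩, ⟨s, t⟩⟩ h
    simp only [Finset.mem_sigma, mem_antidiagonal] at h
    obtain ⟨_, rfl, rfl⟩ := h
    rfl
  · rintro ⟨⟨a, b⟩, ⟨p, q⟩, ⟨s, t⟩⟩ h
    simp only [Finset.mem_sigma, mem_antidiagonal] at h
    obtain ⟨_, rfl, rfl⟩ := h
    rfl
  · rintro ⟨⟨a, b⟩, ⟨p, q⟩, ⟨s, t⟩⟩ h
    rfl

theorem extendCoeff_algebraMap (a : K) (n : ℕ) :
    ψ.extendCoeff (algebraMap K (PowerSeries R) a) n = if n = 0 then algebraMap K R a else 0 := by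
  rw [extendCoeff, Finset.sum_eq_single (n, 0)]
  · simp [PowerSeries.algebraMap_apply, coeff_algebraMap]
  · rintro ⟨i, j⟩ _ hij
    have hj : j ≠ 0 := by
      rintro rfl
      simp_all
    simp [PowerSeries.algebraMap_apply, PowerSeries.coeff_C, hj, coeff]
  · simp

/-- The endomorphism `ψ⟦T⟧` of `R⟦T⟧`. -/
def extend : PowerSeries R →ₐ[K] PowerSeries R where
  toFun f := PowerSeries.mk (ψ.extendCoeff f)
  map_one' := by
    ext n
    rw [PowerSeries.coeff_mk, ← map_one (algebraMap K (PowerSeries R)), extendCoeff_algebraMap,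
      PowerSeries.algebraMap_apply, PowerSeries.coeff_C]
  map_zero' := by ext n; simp [extendCoeff, coeff]
  map_mul' f g := by
    ext n
    simp [PowerSeries.coeff_mul, extendCoeff_mul]
  map_add' f g := by ext n; simp [extendCoeff, coeff_add, Finset.sum_add_distrib]
  commutes' a := by
    ext n
    rw [PowerSeries.coeff_mk, extendCoeff_algebraMap, PowerSeries.algebraMap_apply,
      PowerSeries.coeff_C]

/-- The product `ψ₁ ψ₂ = ψ₁⟦T⟧ ∘ ψ₂` in `HD_K(R)`. -/
instance : Mul (HigherDer K R) where
  mul ψ₁ ψ₂ :=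
    { toAlgHom := ψ₁.extend.comp ψ₂.toAlgHom
      constantCoeff_apply := fun r => by
        rw [← PowerSeries.coeff_zero_eq_constantCoeff_apply]
        have h := ψ₂.constantCoeff_apply r
        simp [extend, extendCoeff, h, ψ₁.coeff_zero] }

theorem mul_coeff (ψ₁ ψ₂ : HigherDer K R) (k : ℕ) (r : R) :
    (ψ₁ * ψ₂).coeff k r = ∑ ij ∈ antidiagonal k, ψ₁.coeff ij.1 (ψ₂.coeff ij.2 r) :=
  PowerSeries.coeff_mk k (ψ₁.extendCoeff (ψ₂.toAlgHom r))

end HigherDer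

end HigherDerivations

section Modules

variable (K : Type w) (R : Type u) [Field K] [CommRing R] [Algebra K R]
variable (M : Type v) [AddCommGroup M] [Module R M]

/-! ### Higher connections, iterative connections, integrability -/

/-- The homogeneous component of degree `k` of the graded module `(G / I) ⊗ M`: the image of
`(Dif_{R/K})ₖ ⊗ M`. -/
def homComp (k : ℕ) : Submodule R (DifGr K R ⊗[R] M) :=
  LinearMap.range ((DifGr.comp K R k).subtype.rTensor M)

/-- The complete graded module `Dif_{R/K} ⊗ M = ∏ₖ (Dif_{R/K})ₖ ⊗ M`: its elements are the
(convergent) sums `∑ₖ xₖ` with `xₖ` homogeneous of degree `k`. -/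
abbrev DifTensor : Type (max u v) := ∀ k : ℕ, homComp K R M k

/-- A higher connection on `M`: an additive map `∇ : M → Dif_{R/K} ⊗ M` with
`(ε ⊗ id) ∘ ∇ = id` and `∇(r m) = d_R(r) ∇(m)`. Both conditions are written out in the homogeneous
components `∇^{(k)}`. -/
@[ext]
structure HigherConnection where
  /-- The underlying additive map; `toFun m k` is `∇^{(k)}(m)`. -/
  toFun : M →+ DifTensor K R M
  map_aug : ∀ m, (toFun m 0 : DifGr K R ⊗[R] M) = 1 ⊗ₜ[R] m
  map_smul : ∀ (r : R) (m : M) (k : ℕ), (toFun (r • m) k : DifGr K R ⊗[R] M) =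
    ∑ ij ∈ antidiagonal k, DifGr.d K R ij.1 r • (toFun m ij.2 : DifGr K R ⊗[R] M)

/-- An (ordinary) connection on `M`: an additive map `∇ : M → Ω_{R/K} ⊗ M` with
`∇(r m) = r ∇(m) + d r ⊗ m`. -/
@[ext]
structure Connection where
  /-- The underlying additive map. -/
  toFun : M →+ Ω[R⁄K] ⊗[R] M
  leibniz : ∀ (r : R) (m : M),
    toFun (r • m) = r • toFun m + KaehlerDifferential.D K R r ⊗ₜ[R] m

variable {K R M}

namespace Connection

variable (c : Connection K R M)

/-- The map `∇_∂ : M → M` for a derivation `∂ ∈ Der(R/K)`. -/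
def along (der : Derivation K R R) : M →+ M :=
  ((TensorProduct.lid R M).toLinearMap ∘ₗ
    der.liftKaehlerDifferential.rTensor M).toAddMonoidHom.comp c.toFun

/-- A connection is integrable if it preserves commutators of derivations:
`∇_{[∂₁, ∂₂]} = [∇_{∂₁}, ∇_{∂₂}]`. -/
def Integrable : Prop :=
  ∀ (der₁ der₂ : Derivation K R R) (m : M),
    c.along ⁅der₁, der₂⁆ m = c.along der₁ (c.along der₂ m) - c.along der₂ (c.along der₁ m)

end Connection

namespace HigherConnection

variable (c : HigherConnection K R M)

/-- The component `∇^{(k)} : M → (Dif_{R/K})ₖ ⊗ M ⊆ (G / I) ⊗ M`. -/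
def coeff (k : ℕ) : M →+ DifGr K R ⊗[R] M where
  toFun m := c.toFun m k
  map_zero' := by simp
  map_add' x y := by simp

theorem coeff_smul (r : R) (m : M) (k : ℕ) :
    c.coeff k (r • m) = ∑ ij ∈ antidiagonal k, DifGr.d K R ij.1 r • c.coeff ij.2 m :=
  c.map_smul r m k

/-- The map `(ω, x) ↦ ∑_{a + b = i} d_Dif^{(a)}(ω) ∇^{(b)}(x)`, additive in both variables. -/
def extendBil (i : ℕ) : DifGr K R →+ M →+ DifGr K R ⊗[R] M :=
  AddMonoidHom.mk' (fun ω => AddMonoidHom.mk'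
      (fun x => ∑ ab ∈ antidiagonal i, DifGr.dDifComp K ab.1 ω • c.coeff ab.2 x)
      (fun x y => by simp [smul_add, Finset.sum_add_distrib]))
    (fun ω η => by
      ext x
      simp [add_smul, Finset.sum_add_distrib])

theorem extendBil_apply (i : ℕ) (ω : DifGr K R) (x : M) :
    c.extendBil i ω x = ∑ ab ∈ antidiagonal i, DifGr.dDifComp K ab.1 ω • c.coeff ab.2 x := rfl

/-- The homogeneous component of degree `i` of the extension
`ω ⊗ x ↦ d_Dif(ω) ∇(x)` of `∇` to `Dif_{R/K} ⊗ M`, on the dense submodule of finite sums. -/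
def extend (i : ℕ) : DifGr K R ⊗[R] M →+ DifGr K R ⊗[R] M :=
  TensorProduct.liftAddHom (c.extendBil i) (fun r ω x => by
    simp only [extendBil_apply, coeff_smul, Finset.smul_sum, Algebra.smul_def,
      DifGr.dDifComp_mul, DifGr.dDifComp_algebraMap, Finset.sum_smul, smul_smul]
    simp only [Finset.sum_sigma']
    refine Finset.sum_nbij'
      (fun x => ⟨(x.2.2, x.2.1 + x.1.2), (x.2.1, x.1.2)⟩)
      (fun y => ⟨(y.2.1 + y.1.1, y.2.2), (y.2.1, y.1.1)⟩) ?_ ?_ ?_ ?_ ?_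
    · rintro ⟨⟨a, b⟩, ⟨p, q⟩⟩ h
      simp only [Finset.mem_sigma, mem_antidiagonal] at h ⊢
      refine ⟨?_, ?_⟩ <;> grind
    · rintro ⟨⟨a, b⟩, ⟨p, q⟩⟩ h
      simp only [Finset.mem_sigma, mem_antidiagonal] at h ⊢
      refine ⟨?_, ?_⟩ <;> grind
    · rintro ⟨⟨a, b⟩, ⟨p, q⟩⟩ h
      simp only [Finset.mem_sigma, mem_antidiagonal] at h
      obtain ⟨_, rfl⟩ := h
      rfl
    · rintro ⟨⟨a, b⟩, ⟨p, q⟩⟩ h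
      simp only [Finset.mem_sigma, mem_antidiagonal] at h
      obtain ⟨_, rfl⟩ := h
      rfl
    · rintro ⟨⟨a, b⟩, ⟨p, q⟩⟩ h
      simp only [mul_comm])

theorem extend_tmul (i : ℕ) (ω : DifGr K R) (x : M) :
    c.extend i (ω ⊗ₜ[R] x) =
      ∑ ab ∈ antidiagonal i, DifGr.dDifComp K ab.1 ω • c.coeff ab.2 x := rfl

/-- A higher connection is iterative if its extension to `Dif_{R/K} ⊗ M` satisfies
`∇^{(i)} ∘ ∇^{(j)} = (i+j choose i) ∇^{(i+j)}` for all `i, j`. -/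
def Iterative : Prop :=
  ∀ (i j : ℕ) (z : DifGr K R ⊗[R] M),
    c.extend i (c.extend j z) = (i + j).choose i • c.extend (i + j) z

/-- The components `∇_ψ^{(k)} : M → M` of the `ψ`-derivation
`∇_ψ = (ψ̃ ⊗ id) ∘ ∇ : M → R⟦T⟧ ⊗ M = M⟦T⟧`. -/
def along (ψ : HigherDer K R) (k : ℕ) : M →+ M :=
  ((TensorProduct.lid R M).toLinearMap ∘ₗ
    ((PowerSeries.coeff k) ∘ₗ ψ.tilde.toLinearMap).rTensor M).toAddMonoidHom.comp (c.coeff k)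

/-- The integrability condition `∇_{ψ₁ ψ₂} = ∇_{ψ₁} ∇_{ψ₂}` for all `ψ₁, ψ₂ ∈ HD_K(R)`, where
`∇_{ψ₁} ∇_{ψ₂} = ∇_{ψ₁}⟦T⟧ ∘ ∇_{ψ₂}`. -/
def Integrable : Prop :=
  ∀ (ψ₁ ψ₂ : HigherDer K R) (k : ℕ) (m : M),
    c.along (ψ₁ * ψ₂) k m = ∑ ij ∈ antidiagonal k, c.along ψ₁ ij.1 (c.along ψ₂ ij.2 m)

/-- The ordinary connection `∇^{(1)} : M → (Dif_{R/K})₁ ⊗ M ≃ Ω_{R/K} ⊗ M`. -/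
def firstOrder : Connection K R M where
  toFun := ((DifGr.toKaehler K).rTensor M).toAddMonoidHom.comp (c.coeff 1)
  leibniz r m := by
    have h0 : c.coeff 0 m = 1 ⊗ₜ[R] m := c.map_aug m
    simp [coeff_smul, Finset.Nat.antidiagonal_succ, h0, DifGr.d_zero, TensorProduct.smul_tmul',
      DifGr.toKaehler_d_one]

end HigherConnection

end Modules

section Categories

variable (K : Type w) (R : Type u) [Field K] [CommRing R] [Algebra K R]

/-! ### The categories -/

/-- Objects of `HCon(R/K)`: finitely generated `R`-modules with higher connection. -/
structure HCon where
  /-- The underlying module. -/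
  module : ModuleCat.{v} R
  finite : Module.Finite R module
  /-- The higher connection. -/
  conn : HigherConnection K R module

/-- Finitely generated `R`-modules with (ordinary) connection. -/
structure Con where
  /-- The underlying module. -/
  module : ModuleCat.{v} R
  finite : Module.Finite R module
  /-- The connection. -/
  conn : Connection K R module

variable {K R}

/-- Morphisms of modules with higher connection: `(id ⊗ f) ∘ ∇₁ = ∇₂ ∘ f`. -/
@[ext]
structure HCon.Hom (X Y : HCon.{w, u, v} K R) where
  /-- The underlying linear map. -/
  hom : X.module →ₗ[R] Y.module
  comm : ∀ (k : ℕ) (m : X.module),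
    hom.lTensor (DifGr K R) (X.conn.coeff k m) = Y.conn.coeff k (hom m)

/-- Morphisms of modules with connection: `(id ⊗ f) ∘ ∇₁ = ∇₂ ∘ f`. -/
@[ext]
structure Con.Hom (X Y : Con.{w, u, v} K R) where
  /-- The underlying linear map. -/
  hom : X.module →ₗ[R] Y.module
  comm : ∀ m : X.module, hom.lTensor (Ω[R⁄K]) (X.conn.toFun m) = Y.conn.toFun (hom m)

instance : Category (HCon.{w, u, v} K R) where
  Hom := HCon.Hom
  id X := ⟨LinearMap.id, by simp⟩
  comp f g := ⟨g.hom ∘ₗ f.hom, fun k m => by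
    rw [LinearMap.lTensor_comp_apply, f.comm, g.comm, LinearMap.comp_apply]⟩

instance : Category (Con.{w, u, v} K R) where
  Hom := Con.Hom
  id X := ⟨LinearMap.id, by simp⟩
  comp f g := ⟨g.hom ∘ₗ f.hom, fun m => by
    rw [LinearMap.lTensor_comp_apply, f.comm, g.comm, LinearMap.comp_apply]⟩

variable (K R)

/-- The functor `(M, ∇) ↦ (M, ∇^{(1)})`, `f ↦ f` from modules with higher connection to modules
with connection. -/
def hconToCon : HCon.{w, u, v} K R ⥤ Con.{w, u, v} K R where
  obj X := ⟨X.module, X.finite, X.conn.firstOrder⟩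
  map {X Y} f := Con.Hom.mk f.hom fun m => by
    have h := f.comm 1 m
    change f.hom.lTensor (Ω[R⁄K]) ((DifGr.toKaehler K).rTensor X.module (X.conn.coeff 1 m)) =
      (DifGr.toKaehler K).rTensor Y.module (Y.conn.coeff 1 (f.hom m))
    rw [← h, ← LinearMap.comp_apply, ← LinearMap.comp_apply, LinearMap.lTensor_comp_rTensor,
      LinearMap.rTensor_comp_lTensor]

/-- The property of being a module with iterative connection. -/
def isIterative : ObjectProperty (HCon.{w, u, v} K R) := fun X => X.conn.Iterative

/-- The property of being a module with integrable iterative connection. -/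
def isIntegrableIterative : ObjectProperty (HCon.{w, u, v} K R) :=
  fun X => X.conn.Iterative ∧ X.conn.Integrable

/-- The property of being a module with integrable connection. -/
def isIntegrable : ObjectProperty (Con.{w, u, v} K R) := fun X => X.conn.Integrable

/-- The category `ICon(R/K)` of finitely generated modules with iterative connection. -/
abbrev ICon := (isIterative.{w, u, v} K R).FullSubcategory

/-- The category `ICon_int(R/K)` of finitely generated modules with integrable iterative
connection. -/
abbrev IConInt := (isIntegrableIterative.{w, u, v} K R).FullSubcategory

/-- The category of finitely generated modules with integrable connection. -/
abbrev ConInt := (isIntegrable.{w, u, v} K R).FullSubcategory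

/-- The functor `(M, ∇) ↦ (M, ∇^{(1)})` on modules with iterative connection. -/
abbrev iconToCon : ICon.{w, u, v} K R ⥤ Con.{w, u, v} K R :=
  (isIterative K R).ι ⋙ hconToCon K R

/-- The functor `(M, ∇) ↦ (M, ∇^{(1)})` on modules with integrable iterative connection. -/
abbrev iconIntToCon : IConInt.{w, u, v} K R ⥤ Con.{w, u, v} K R :=
  (isIntegrableIterative K R).ι ⋙ hconToCon K R

end Categories

end IterConn
end

/-! ### Weighted sums over antidiagonals and division by integers in characteristic zero. -/

namespace IterConn

/-! Let `D` be the degree-one part of the extension of `∇` to `Dif ⊗ M`. It satisfies `D(ω ⊗ m) =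
d_Dif^{(1)}(ω) ⊗ m + ω ∇^{(1)}(m)`, so it depends only on `∇^{(1)}`. In an iterative connection `D
∇^{(k)} = (k+1) ∇^{(k+1)}`, hence `∇^{(k)} = D^k / k!` on `M`; this gives uniqueness, and also shows
that a linear map compatible with `∇^{(1)}` is compatible with every `∇^{(k)}`
(`Iterative.coeff_comm`). Conversely any connection defines such a `D`, and the maps `D^k / k!` form
an iterative connection (`toHigher_iterative`). The bijection and the equivalences of categories
follow.

For integrability, regard `ψ` and `∇_ψ` as power series `Ψ` and `F_ψ` over `End R` and `End M`, and
write `'` for the Euler operator `T d/dT`. The logarithmic derivative of `ψ` consists of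
derivations: `Ψ' = Ψ θ` with `θ = ∑ θ_n T^n`, `θ_n ∈ Der(R/K)`. Iterativity gives `F_ψ' = F_ψ ∇_θ`
(`Iterative.euler_alongSeries`), an equation whose solution is determined by its constant term.

If `∇^{(1)}` is integrable, then `∂ ↦ ∇_∂` respects brackets, so conjugation of derivations by `ψ₂`
on `R` carries over to conjugation by `F_{ψ₂}` on `M`. Therefore `F_{ψ₁} F_{ψ₂}` and `F_{ψ₁ψ₂}`
solve the same equation, with logarithmic derivative `ψ₂⁻¹ θ₁ ψ₂ + θ₂`, and coincide. For the
converse, compare the coefficients of `T²` for `ψ₁ = exp(aT)` and `ψ₂ = exp(bT)`. -/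

theorem sum_antidiagonal_succ_nsmul {N : Type*} [AddCommMonoid N] (f : ℕ → ℕ → N) (n : ℕ) :
    ∑ ab ∈ antidiagonal n, ((ab.1 + 1) • f (ab.1 + 1) ab.2 + (ab.2 + 1) • f ab.1 (ab.2 + 1)) =
      (n + 1) • ∑ ab ∈ antidiagonal (n + 1), f ab.1 ab.2 := by
  have h : (n + 1) • ∑ ab ∈ antidiagonal (n + 1), f ab.1 ab.2 =
      ∑ ab ∈ antidiagonal (n + 1), ab.1 • f ab.1 ab.2 +
        ∑ ab ∈ antidiagonal (n + 1), ab.2 • f ab.1 ab.2 := by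
    rw [Finset.smul_sum, ← Finset.sum_add_distrib]
    refine Finset.sum_congr rfl fun ab hab => ?_
    rw [← add_smul, mem_antidiagonal.1 hab]
  -- After `n + 1 = a + b` is split, the boundary terms `a = 0` and `b = 0` carry weight zero, so
  -- both shifted sums are complete.
  rw [h, Finset.sum_add_distrib, Finset.Nat.sum_antidiagonal_succ, Finset.Nat.sum_antidiagonal_succ']
  simp

/-- `N` becomes a `K`-vector space through `R`, and `n` is a unit of `K`. -/
theorem nsmul_right_injective_of_algebra (K : Type*) {R : Type*} {N : Type*} [Field K] [CharZero K]
    [CommRing R] [Algebra K R] [AddCommGroup N] [Module R N] {n : ℕ} (hn : n ≠ 0) {x y : N}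
    (h : n • x = n • y) : x = y := by
  let := Module.compHom N (algebraMap K R)
  have hK : (n : K) ≠ 0 := Nat.cast_ne_zero.2 hn
  rw [← Nat.cast_smul_eq_nsmul K, ← Nat.cast_smul_eq_nsmul K] at h
  simpa [smul_smul, hK] using congrArg (fun z => (n : K)⁻¹ • z) h

/-! ### The degree-one derivation of the algebra of higher differentials. -/

namespace DifGr

variable (K : Type w) {R : Type u} [Field K] [CommRing R] [Algebra K R]

theorem induction_d {p : DifGr K R → Prop} (hd : ∀ k r, p (d K R k r))
    (hadd : ∀ x y, p x → p y → p (x + y)) (hmul : ∀ x y, p x → p y → p (x * y))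
    (x : DifGr K R) : p x := by
  obtain ⟨q, rfl⟩ : ∃ q, mk K R q = x := Ideal.Quotient.mk_surjective x
  induction q using MvPolynomial.induction_on with
  | C r => exact hd 0 r
  | add f g hf hg => rw [map_add]; exact hadd _ _ hf hg
  | mul_X f i hf => rw [map_mul]; exact hmul _ _ hf (hd (i.1 + 1) i.2)

theorem dDifComp_zero (x : DifGr K R) : dDifComp K 0 x = x := by
  induction x using induction_d with
  | hd k r => simp [dDifComp_d]
  | hadd x y hx hy => rw [map_add, hx, hy]
  | hmul x y hx hy => simp [dDifComp_mul, hx, hy]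

theorem dDifComp_one_mul (x y : DifGr K R) :
    dDifComp K 1 (x * y) = dDifComp K 1 x * y + x * dDifComp K 1 y := by
  simp [dDifComp_mul, Finset.Nat.antidiagonal_succ, dDifComp_zero, add_comm]

theorem dDifComp_one_d (k : ℕ) (r : R) :
    dDifComp K 1 (d K R k r) = (k + 1) • d K R (k + 1) r := by
  simp [dDifComp_d]

/-- On generators this is `(n+1) C(k+n+1, n+1) = (k+n+1) C(k+n, n)`; the product rule and
`sum_antidiagonal_succ_nsmul` carry it over to products. -/
theorem dDifComp_one_dDifComp (n : ℕ) (x : DifGr K R) :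
    dDifComp K 1 (dDifComp K n x) = (n + 1) • dDifComp K (n + 1) x := by
  induction x using induction_d generalizing n with
  | hd k r =>
    rw [dDifComp_d, dDifComp_d, ← nsmul_eq_mul, map_nsmul, dDifComp_one_d, smul_smul,
      ← nsmul_eq_mul, smul_smul]
    congr 1
    have h := Nat.add_one_mul_choose_eq (k + n) n
    rw [← add_assoc] 
    linarith
  | hadd x y hx hy => simp only [map_add, hx, hy, smul_add]
  | hmul x y hx hy =>
    rw [dDifComp_mul, dDifComp_mul, map_sum,
      ← sum_antidiagonal_succ_nsmul (fun a b => dDifComp K a x * dDifComp K b y)]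
    refine Finset.sum_congr rfl fun ab _ => ?_
    rw [dDifComp_one_mul, hx, hy, smul_mul_assoc, mul_smul_comm]

theorem dDifComp_one_one (n : ℕ) : dDifComp K (R := R) n 1 = if n = 0 then 1 else 0 := by
  rw [← map_one (algebraMap R (DifGr K R)), dDifComp_algebraMap, d_one, map_one]

variable {K}

theorem mul_mem_comp {k l : ℕ} {x y : DifGr K R} (hx : x ∈ comp K R k) (hy : y ∈ comp K R l) :
    x * y ∈ comp K R (k + l) := by
  obtain ⟨p, hp, rfl⟩ := hx
  obtain ⟨q, hq, rfl⟩ := hy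
  exact ⟨p * q, MvPolynomial.IsWeightedHomogeneous.mul hp hq, map_mul (mk K R) p q⟩

theorem d_mem_comp (k : ℕ) (r : R) : d K R k r ∈ comp K R k := by
  rcases k with _ | k
  · exact ⟨_, MvPolynomial.isWeightedHomogeneous_C _ r, rfl⟩
  · exact ⟨_, MvPolynomial.isWeightedHomogeneous_X R _ (k, r), rfl⟩

theorem mk_monomial_mem_comp (m : ℕ × R →₀ ℕ) (a : R) :
    mk K R (MvPolynomial.monomial m a) ∈
      comp K R (Finsupp.weight (fun i : ℕ × R => i.1 + 1) m) :=
  ⟨_, MvPolynomial.isWeightedHomogeneous_monomial _ _ _ rfl, rfl⟩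

theorem dDifComp_one_mul_mem {k l : ℕ} {x y : DifGr K R} (hx : x ∈ comp K R k)
    (hy : y ∈ comp K R l) (hx' : dDifComp K 1 x ∈ comp K R (k + 1))
    (hy' : dDifComp K 1 y ∈ comp K R (l + 1)) :
    dDifComp K 1 (x * y) ∈ comp K R (k + l + 1) := by
  rw [dDifComp_one_mul]
  refine add_mem ?_ ?_
  · rw [add_right_comm]
    exact mul_mem_comp hx' hy
  · rw [add_assoc]
    exact mul_mem_comp hx hy'

/-- The product rule reduces a monomial to its factors: a coefficient `a = d^{(0)} a` goes to
`d^{(1)} a`, and a variable `d^{(k)} r` to a multiple of `d^{(k+1)} r`. -/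
theorem dDifComp_one_monomial_mem (m : ℕ × R →₀ ℕ) (a : R) :
    dDifComp K 1 (mk K R (MvPolynomial.monomial m a)) ∈
      comp K R (Finsupp.weight (fun i : ℕ × R => i.1 + 1) m + 1) := by
  induction m using Finsupp.induction_linear generalizing a with
  | zero =>
    rw [map_zero]
    change dDifComp K 1 (d K R 0 a) ∈ _
    rw [dDifComp_one_d]
    exact nsmul_mem (d_mem_comp 1 a) _
  | add m n hm hn =>
    rw [← mul_one a, ← MvPolynomial.monomial_mul, map_mul, map_add]
    exact dDifComp_one_mul_mem (mk_monomial_mem_comp m a) (mk_monomial_mem_comp n 1) (hm a) (hn 1)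
  | single i n =>
    induction n generalizing a with
    | zero =>
      rw [Finsupp.single_zero, map_zero]
      change dDifComp K 1 (d K R 0 a) ∈ _
      rw [dDifComp_one_d]
      exact nsmul_mem (d_mem_comp 1 a) _
    | succ n ih =>
      rw [Finsupp.single_add, ← mul_one a, ← MvPolynomial.monomial_mul, map_mul, map_add]
      refine dDifComp_one_mul_mem (mk_monomial_mem_comp _ a) (mk_monomial_mem_comp _ 1) (ih a) ?_
      change dDifComp K 1 (d K R (i.1 + 1) i.2) ∈ _
      rw [dDifComp_one_d, Finsupp.weight_single, one_smul]
      exact nsmul_mem (d_mem_comp _ _) _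

theorem dDifComp_one_mem {k : ℕ} {x : DifGr K R} (hx : x ∈ comp K R k) :
    dDifComp K 1 x ∈ comp K R (k + 1) := by
  obtain ⟨p, hp, rfl⟩ := hx
  rw [p.as_sum, map_sum, map_sum]
  refine sum_mem fun m hm => ?_
  rw [← hp (MvPolynomial.mem_support_iff.1 hm)]
  exact dDifComp_one_monomial_mem m _

end DifGr

end IterConn

/-! ### The degree-one part of `Dif ⊗ M` as `Ω ⊗ M`. -/

namespace IterConn

variable {K : Type w} {R : Type u} [Field K] [CommRing R] [Algebra K R]
variable {M : Type v} [AddCommGroup M] [Module R M]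

/-- The `R`-linear map `Ω_{R/K} ⊗ M → Dif_{R/K} ⊗ M` that maps `dr ⊗ m` to `d^{(1)} r ⊗ m`. -/
noncomputable def ofKaehlerTensor (K : Type w) (R : Type u) [Field K] [CommRing R] [Algebra K R]
    (M : Type v) [AddCommGroup M] [Module R M] : Ω[R⁄K] ⊗[R] M →ₗ[R] DifGr K R ⊗[R] M :=
  (DifGr.dOne K (R := R)).liftKaehlerDifferential.rTensor M

theorem toKaehler_ofKaehlerTensor (z : Ω[R⁄K] ⊗[R] M) :
    (DifGr.toKaehler K).rTensor M (ofKaehlerTensor K R M z) = z := by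
  induction z with
  | zero => simp
  | add x y hx hy => rw [map_add, map_add, hx, hy]
  | tmul ω m => simp [ofKaehlerTensor, DifGr.toKaehler_lift]

theorem ofKaehlerTensor_toKaehler {z : DifGr K R ⊗[R] M} (hz : z ∈ homComp K R M 1) :
    ofKaehlerTensor K R M ((DifGr.toKaehler K).rTensor M z) = z := by
  obtain ⟨y, rfl⟩ := hz
  induction y with
  | zero => simp
  | add x y hx hy => rw [map_add, map_add, map_add, hx, hy]
  | tmul ω m => simp [ofKaehlerTensor, DifGr.lift_toKaehler K ω.2]

theorem tmul_mem_homComp {k : ℕ} {ω : DifGr K R} (hω : ω ∈ DifGr.comp K R k) (m : M) :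
    ω ⊗ₜ[R] m ∈ homComp K R M k :=
  ⟨⟨ω, hω⟩ ⊗ₜ m, rfl⟩

theorem smul_mem_homComp {k l : ℕ} {ω : DifGr K R} (hω : ω ∈ DifGr.comp K R k)
    {z : DifGr K R ⊗[R] M} (hz : z ∈ homComp K R M l) : ω • z ∈ homComp K R M (k + l) := by
  obtain ⟨y, rfl⟩ := hz
  induction y with
  | zero => simp
  | add x y hx hy => rw [map_add, smul_add]; exact add_mem hx hy
  | tmul η m => exact tmul_mem_homComp (DifGr.mul_mem_comp hω η.2) m

theorem ofKaehlerTensor_mem (z : Ω[R⁄K] ⊗[R] M) : ofKaehlerTensor K R M z ∈ homComp K R M 1 := by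
  induction z with
  | zero => simp
  | add x y hx hy => rw [map_add]; exact add_mem hx hy
  | tmul ω m => exact tmul_mem_homComp (DifGr.lift_mem K ω) m

theorem lTensor_ofKaehlerTensor {N : Type*} [AddCommGroup N] [Module R N] (f : M →ₗ[R] N)
    (z : Ω[R⁄K] ⊗[R] M) :
    f.lTensor (DifGr K R) (ofKaehlerTensor K R M z) =
      ofKaehlerTensor K R N (f.lTensor (Ω[R⁄K]) z) := by
  simp only [ofKaehlerTensor, ← LinearMap.comp_apply, LinearMap.lTensor_comp_rTensor,
    LinearMap.rTensor_comp_lTensor]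

/-! ### Iterative connections are governed by their degree-one part. -/

namespace HigherConnection

variable (c : HigherConnection K R M)

theorem coeff_zero (m : M) : c.coeff 0 m = 1 ⊗ₜ[R] m := c.map_aug m

theorem coeff_one (m : M) : c.coeff 1 m = ofKaehlerTensor K R M (c.firstOrder.toFun m) :=
  (ofKaehlerTensor_toKaehler (c.toFun m 1).2).symm

theorem extend_one_tmul (i : ℕ) (m : M) : c.extend i (1 ⊗ₜ[R] m) = c.coeff i m := by
  rw [extend_tmul, Finset.sum_eq_single (0, i)]
  · simp [DifGr.dDifComp_one_one]
  · rintro ⟨a, b⟩ hab hne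
    have : a ≠ 0 := by
      rintro rfl
      simp_all
    simp [DifGr.dDifComp_one_one, this]
  · simp

theorem extend_zero (z : DifGr K R ⊗[R] M) : c.extend 0 z = z := by
  induction z with
  | zero => simp
  | add x y hx hy => rw [map_add, hx, hy]
  | tmul ω m => simp [extend_tmul, DifGr.dDifComp_zero, coeff_zero, TensorProduct.smul_tmul']

theorem extend_one (ω : DifGr K R) (m : M) :
    c.extend 1 (ω ⊗ₜ[R] m) = DifGr.dDifComp K 1 ω ⊗ₜ[R] m + ω • c.coeff 1 m := by
  simp [extend_tmul, Finset.Nat.antidiagonal_succ, DifGr.dDifComp_zero, coeff_zero,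
    TensorProduct.smul_tmul', add_comm]

theorem extend_one_smul (ω : DifGr K R) (z : DifGr K R ⊗[R] M) :
    c.extend 1 (ω • z) = DifGr.dDifComp K 1 ω • z + ω • c.extend 1 z := by
  induction z with
  | zero => simp
  | add x y hx hy =>
    rw [smul_add, map_add, hx, hy, map_add, smul_add, smul_add]
    abel
  | tmul η m =>
    rw [TensorProduct.smul_tmul', extend_one, extend_one, smul_eq_mul, DifGr.dDifComp_one_mul,
      TensorProduct.add_tmul, smul_add, TensorProduct.smul_tmul', TensorProduct.smul_tmul',
      smul_eq_mul, smul_eq_mul, mul_smul, add_assoc]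

variable {c}

theorem Iterative.extend_one_coeff (hc : c.Iterative) (n : ℕ) (m : M) :
    c.extend 1 (c.coeff n m) = (n + 1) • c.coeff (n + 1) m := by
  rw [← extend_one_tmul, hc, extend_one_tmul, Nat.choose_one_right, add_comm]

/-- The opposite order of composition to `Iterative.extend_one_coeff`: that one is the recursion for
`∇^{(k)}`, this one produces the differential equation for `∇_ψ`. -/
theorem Iterative.extend_coeff_one (hc : c.Iterative) (n : ℕ) (m : M) :
    c.extend n (c.coeff 1 m) = (n + 1) • c.coeff (n + 1) m := by
  rw [← extend_one_tmul, hc, extend_one_tmul, Nat.choose_symm_add, Nat.choose_one_right]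

theorem extend_one_extend
    (hc : ∀ n m, c.extend 1 (c.coeff n m) = (n + 1) • c.coeff (n + 1) m) (n : ℕ)
    (z : DifGr K R ⊗[R] M) : c.extend 1 (c.extend n z) = (n + 1) • c.extend (n + 1) z := by
  induction z with
  | zero => simp
  | add x y hx hy => simp only [map_add, hx, hy, smul_add]
  | tmul ω m =>
    rw [extend_tmul, extend_tmul, map_sum,
      ← sum_antidiagonal_succ_nsmul (fun a b => DifGr.dDifComp K a ω • c.coeff b m)]
    refine Finset.sum_congr rfl fun ab _ => ?_
    rw [extend_one_smul, DifGr.dDifComp_one_dDifComp, hc, smul_assoc, smul_comm ab.2.succ]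

variable [CharZero K]

/-- Since `(i+1) ∇^{(i+1)} = ∇^{(1)} ∇^{(i)}` on all of `Dif ⊗ M`, induction on `i` yields each
relation multiplied by `i + 1`, which can be cancelled. -/
theorem iterative_of_extend_one_coeff
    (hc : ∀ n m, c.extend 1 (c.coeff n m) = (n + 1) • c.coeff (n + 1) m) : c.Iterative := by
  intro i j z
  induction i with
  | zero => simp [extend_zero]
  | succ i ih =>
    apply nsmul_right_injective_of_algebra K (R := R) (Nat.succ_ne_zero i)
    rw [Nat.succ_eq_add_one, ← extend_one_extend hc, ih, map_nsmul, extend_one_extend hc, smul_smul,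
      smul_smul]
    have h := Nat.add_one_mul_choose_eq (i + j) i
    rw [add_right_comm i 1 j]
    congr 1
    linarith

/-- `id ⊗ f` intertwines the two operators `D`, hence the components `D^k / k!`. General `f` gives
fullness of the functors, `f = id` gives uniqueness. -/
theorem Iterative.coeff_comm {N : Type*} [AddCommGroup N] [Module R N]
    {c' : HigherConnection K R N} (hc : c.Iterative) (hc' : c'.Iterative) (f : M →ₗ[R] N)
    (h : ∀ m, f.lTensor (Ω[R⁄K]) (c.firstOrder.toFun m) = c'.firstOrder.toFun (f m)) (k : ℕ)
    (m : M) : f.lTensor (DifGr K R) (c.coeff k m) = c'.coeff k (f m) := by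
  have h1 : ∀ m, f.lTensor (DifGr K R) (c.coeff 1 m) = c'.coeff 1 (f m) := fun m => by
    rw [coeff_one, coeff_one, ← h, lTensor_ofKaehlerTensor]
  have hsmul : ∀ (ω : DifGr K R) (z : DifGr K R ⊗[R] M),
      f.lTensor (DifGr K R) (ω • z) = ω • f.lTensor (DifGr K R) z := fun ω z => by
    induction z with
    | zero => simp
    | add x y hx hy => simp only [smul_add, map_add, hx, hy]
    | tmul η m => simp [TensorProduct.smul_tmul']
  have hext : ∀ z, f.lTensor (DifGr K R) (c.extend 1 z) =
      c'.extend 1 (f.lTensor (DifGr K R) z) := fun z => by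
    induction z with
    | zero => simp
    | add x y hx hy => simp only [map_add, hx, hy]
    | tmul ω m => rw [extend_one, map_add, hsmul, h1, LinearMap.lTensor_tmul,
        LinearMap.lTensor_tmul, extend_one]
  induction k with
  | zero => rw [coeff_zero, coeff_zero, LinearMap.lTensor_tmul]
  | succ k ih =>
    apply nsmul_right_injective_of_algebra K (R := R) (Nat.succ_ne_zero k)
    rw [Nat.succ_eq_add_one, ← map_nsmul, ← hc.extend_one_coeff, hext, ih, hc'.extend_one_coeff]

theorem Iterative.eq_of_firstOrder_eq {c' : HigherConnection K R M} (hc : c.Iterative)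
    (hc' : c'.Iterative) (h : c.firstOrder = c'.firstOrder) : c = c' := by
  ext m k
  have := hc.coeff_comm hc' LinearMap.id (fun m => by simp [h]) k m
  rwa [LinearMap.lTensor_id, LinearMap.id_apply, LinearMap.id_apply] at this

end HigherConnection

/-! ### The iterative connection `D^k / k!` of a connection. -/

namespace Connection

variable (c : Connection K R M)

/-- The additive operator `ω ⊗ m ↦ d_Dif^{(1)} ω ⊗ m + ω ∇(m)` on `Dif_{R/K} ⊗ M`. -/
noncomputable def difOp : DifGr K R ⊗[R] M →+ DifGr K R ⊗[R] M :=
  TensorProduct.liftAddHom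
    (AddMonoidHom.mk' (fun ω => AddMonoidHom.mk'
        (fun m => DifGr.dDifComp K 1 ω ⊗ₜ[R] m + ω • ofKaehlerTensor K R M (c.toFun m))
        (fun x y => by simp only [TensorProduct.tmul_add, map_add, smul_add]; abel))
      (fun ω η => by
        ext m
        simp only [AddMonoidHom.mk'_apply, AddMonoidHom.add_apply, map_add, add_smul,
          TensorProduct.add_tmul]
        abel))
    -- Balancedness over `R`: moving `r` across the tensor creates `d^{(1)} r · ω ⊗ m` on one side
    -- from the product rule of `d_Dif^{(1)}`, and on the other from the term `dr ⊗ m` of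
    -- `c.leibniz`.
    (fun r ω m => by
      have h : ofKaehlerTensor K R M (KaehlerDifferential.D K R r ⊗ₜ[R] m) =
          DifGr.d K R 1 r ⊗ₜ[R] m := by
        simp [ofKaehlerTensor, DifGr.dOne_apply]
      simp only [AddMonoidHom.mk'_apply, c.leibniz, map_add, map_smul, h, smul_add,
        Algebra.smul_def r ω, DifGr.dDifComp_one_mul, DifGr.dDifComp_algebraMap,
        TensorProduct.add_tmul, TensorProduct.smul_tmul', smul_eq_mul, mul_smul,
        TensorProduct.tmul_smul]
      rw [← algebraMap_smul (DifGr K R) r (ofKaehlerTensor K R M _),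
        smul_comm ω (algebraMap R (DifGr K R) r), mul_comm ω, Algebra.smul_def r]
      abel)

theorem difOp_tmul (ω : DifGr K R) (m : M) :
    c.difOp (ω ⊗ₜ[R] m) =
      DifGr.dDifComp K 1 ω ⊗ₜ[R] m + ω • ofKaehlerTensor K R M (c.toFun m) := rfl

theorem difOp_smul (ω : DifGr K R) (z : DifGr K R ⊗[R] M) :
    c.difOp (ω • z) = DifGr.dDifComp K 1 ω • z + ω • c.difOp z := by
  induction z with
  | zero => simp
  | add x y hx hy =>
    rw [smul_add, map_add, hx, hy, map_add, smul_add, smul_add]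
    abel
  | tmul η m =>
    rw [TensorProduct.smul_tmul', difOp_tmul, difOp_tmul, smul_eq_mul, DifGr.dDifComp_one_mul,
      TensorProduct.add_tmul, smul_add, TensorProduct.smul_tmul', TensorProduct.smul_tmul',
      smul_eq_mul, smul_eq_mul, mul_smul, add_assoc]

theorem difOp_mem {k : ℕ} {z : DifGr K R ⊗[R] M} (hz : z ∈ homComp K R M k) :
    c.difOp z ∈ homComp K R M (k + 1) := by
  obtain ⟨y, rfl⟩ := hz
  induction y with
  | zero => simp
  | add x y hx hy => rw [map_add, map_add]; exact add_mem hx hy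
  | tmul ω m =>
    exact add_mem (tmul_mem_homComp (DifGr.dDifComp_one_mem ω.2) m)
      (smul_mem_homComp ω.2 (ofKaehlerTensor_mem _))

/-- The components `∇^{(k)} = D^k / k!` of the iterative connection attached to a connection, where
`D` is the operator `difOp`. -/
noncomputable def iterCoeff : ℕ → M →+ DifGr K R ⊗[R] M
  | 0 => (TensorProduct.mk R (DifGr K R) M 1).toAddMonoidHom
  | k + 1 => (DistribSMul.toAddMonoidHom (DifGr K R ⊗[R] M)
      (algebraMap K R ((k + 1 : ℕ) : K)⁻¹)).comp (c.difOp.comp (iterCoeff k))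

theorem iterCoeff_zero (m : M) : c.iterCoeff 0 m = 1 ⊗ₜ[R] m := rfl

theorem iterCoeff_succ (k : ℕ) (m : M) :
    c.iterCoeff (k + 1) m =
      algebraMap K R ((k + 1 : ℕ) : K)⁻¹ • c.difOp (c.iterCoeff k m) := rfl

theorem iterCoeff_mem (k : ℕ) (m : M) : c.iterCoeff k m ∈ homComp K R M k := by
  induction k with
  | zero =>
    refine tmul_mem_homComp ?_ m
    rw [← map_one (algebraMap R (DifGr K R)), ← DifGr.d_zero]
    exact DifGr.d_mem_comp 0 1
  | succ k ih => exact Submodule.smul_mem _ _ (c.difOp_mem ih)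

theorem iterCoeff_one (m : M) : c.iterCoeff 1 m = ofKaehlerTensor K R M (c.toFun m) := by
  rw [iterCoeff_succ, iterCoeff_zero, difOp_tmul, DifGr.dDifComp_one_one]
  simp

variable [CharZero K]

theorem difOp_iterCoeff (k : ℕ) (m : M) :
    c.difOp (c.iterCoeff k m) = (k + 1) • c.iterCoeff (k + 1) m := by
  have hk : ((k + 1 : ℕ) : K) ≠ 0 := Nat.cast_ne_zero.2 (Nat.succ_ne_zero k)
  rw [iterCoeff_succ, ← Nat.cast_smul_eq_nsmul R, smul_smul, ← map_natCast (algebraMap K R),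
    ← map_mul, mul_inv_cancel₀ hk, map_one, one_smul]

/-- The Leibniz formula for `D^k` divided by `k!`, proved by applying `D` to the formula for `k` and
cancelling `k + 1`. -/
theorem iterCoeff_smul (r : R) (m : M) (k : ℕ) :
    c.iterCoeff k (r • m) = ∑ ij ∈ antidiagonal k, DifGr.d K R ij.1 r • c.iterCoeff ij.2 m := by
  induction k with
  | zero => simp [iterCoeff_zero, DifGr.d_zero]
  | succ k ih =>
    apply nsmul_right_injective_of_algebra K (R := R) (Nat.succ_ne_zero k)
    rw [Nat.succ_eq_add_one, ← difOp_iterCoeff, ih, map_sum,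
      ← sum_antidiagonal_succ_nsmul (fun a b => DifGr.d K R a r • c.iterCoeff b m)]
    refine Finset.sum_congr rfl fun ab _ => ?_
    rw [difOp_smul, DifGr.dDifComp_one_d, difOp_iterCoeff, smul_assoc, smul_comm ab.2.succ]

/-- The iterative connection attached to a connection. -/
noncomputable def toHigher : HigherConnection K R M where
  toFun := AddMonoidHom.mk' (fun m k => (⟨c.iterCoeff k m, c.iterCoeff_mem k m⟩ : homComp K R M k))
    (fun x y => by ext k; simp)
  map_aug := c.iterCoeff_zero
  map_smul r m k := c.iterCoeff_smul r m k

theorem toHigher_coeff (k : ℕ) (m : M) : c.toHigher.coeff k m = c.iterCoeff k m := rfl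

theorem toHigher_firstOrder : c.toHigher.firstOrder = c := by
  ext m
  change (DifGr.toKaehler K).rTensor M (c.iterCoeff 1 m) = _
  rw [iterCoeff_one, toKaehler_ofKaehlerTensor]

theorem toHigher_iterative : c.toHigher.Iterative := by
  refine HigherConnection.iterative_of_extend_one_coeff fun n m => ?_
  -- The extension in degree one sees only `∇^{(1)}`, which is the given connection, so it is again
  -- `D`.
  have h : ∀ z, c.toHigher.extend 1 z = c.difOp z := fun z => by
    induction z with
    | zero => simp
    | add x y hx hy => rw [map_add, map_add, hx, hy]
    | tmul ω m => rw [HigherConnection.extend_one, difOp_tmul, toHigher_coeff, iterCoeff_one]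
  rw [h, toHigher_coeff, toHigher_coeff, difOp_iterCoeff]

end Connection

theorem firstOrder_bijective [CharZero K] :
    Function.Bijective
      (fun c : {c : HigherConnection K R M // c.Iterative} => c.1.firstOrder) :=
  ⟨fun c c' h => Subtype.ext (c.2.eq_of_firstOrder_eq c'.2 h),
    fun c => ⟨⟨c.toHigher, c.toHigher_iterative⟩, c.toHigher_firstOrder⟩⟩

/-! ### The equivalences of categories. -/

section Categories

variable (K R) [CharZero K]

/-- A connection as an object is isomorphic to the one with the same module and an equal
connection. -/
def conIsoOfEq (X : Con.{w, u, v} K R) {c : Connection K R X.module} (h : c = X.conn) :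
    (⟨X.module, X.finite, c⟩ : Con.{w, u, v} K R) ≅ X where
  hom := Con.Hom.mk LinearMap.id fun m => by simp [h]
  inv := Con.Hom.mk LinearMap.id fun m => by simp [h]
  hom_inv_id := rfl
  inv_hom_id := rfl

theorem hconToCon_map_bijective {X Y : HCon.{w, u, v} K R} (hX : X.conn.Iterative)
    (hY : Y.conn.Iterative) :
    Function.Bijective fun f : X ⟶ Y => (hconToCon K R).map f :=
  ⟨fun _ _ h => HCon.Hom.ext (congrArg Con.Hom.hom h),
    fun g => ⟨HCon.Hom.mk g.hom (hX.coeff_comm hY g.hom g.comm), rfl⟩⟩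

theorem iconToCon_isEquivalence : (iconToCon.{w, u, v} K R).IsEquivalence where
  faithful := ⟨fun {X Y} f g h => by
    ext1
    exact (hconToCon_map_bijective K R X.2 Y.2).1 h⟩
  full := ⟨fun {X Y} g => by
    obtain ⟨f, hf⟩ := (hconToCon_map_bijective K R X.2 Y.2).2 g
    exact ⟨ObjectProperty.homMk f, hf⟩⟩
  essSurj := ⟨fun Y =>
    ⟨⟨⟨Y.module, Y.finite, Y.conn.toHigher⟩, Y.conn.toHigher_iterative⟩,
      ⟨conIsoOfEq K R Y Y.conn.toHigher_firstOrder⟩⟩⟩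

/-- Integrability imposes nothing on morphisms, so only essential surjectivity needs `hint`: the
lift `D^k / k!` of an integrable connection must be integrable. -/
theorem iconIntToCon_lift_isEquivalence
    (hint : ∀ (X : Con.{w, u, v} K R) (c : HigherConnection K R X.module), c.Iterative →
      (c.Integrable ↔ c.firstOrder.Integrable))
    (h : ∀ X : IConInt.{w, u, v} K R, isIntegrable K R ((iconIntToCon K R).obj X)) :
    ((isIntegrable K R).lift (iconIntToCon K R) h).IsEquivalence where
  faithful := ⟨fun {X Y} f g h => by
    ext1
    exact (hconToCon_map_bijective K R X.2.1 Y.2.1).1 (congrArg (fun f => f.hom) h)⟩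
  full := ⟨fun {X Y} g => by
    obtain ⟨f, hf⟩ := (hconToCon_map_bijective K R X.2.1 Y.2.1).2 g.hom
    exact ⟨ObjectProperty.homMk f, by ext1; exact hf⟩⟩
  essSurj := ⟨fun Y =>
    ⟨⟨⟨Y.1.module, Y.1.finite, Y.1.conn.toHigher⟩, Y.1.conn.toHigher_iterative,
      (hint Y.1 _ Y.1.conn.toHigher_iterative).2 (by
        rw [Y.1.conn.toHigher_firstOrder]; exact Y.2)⟩,
      ⟨ObjectProperty.isoMk _ (conIsoOfEq K R Y.1 Y.1.conn.toHigher_firstOrder)⟩⟩⟩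

end Categories

end IterConn

noncomputable section

namespace IterConn

/-! ### Linear differential equations for noncommutative power series. -/

section Euler

variable {A : Type*} [Ring A]

/-- The Euler operator `T d/dT` on power series over a possibly noncommutative ring. -/
def euler (X : PowerSeries A) : PowerSeries A := PowerSeries.mk fun n => n • PowerSeries.coeff n X

theorem coeff_euler (X : PowerSeries A) (n : ℕ) :
    PowerSeries.coeff n (euler X) = n • PowerSeries.coeff n X := PowerSeries.coeff_mk _ _

theorem euler_mul (X Y : PowerSeries A) : euler (X * Y) = euler X * Y + X * euler Y := by
  ext n
  simp only [coeff_euler, map_add, PowerSeries.coeff_mul, Finset.smul_sum,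
    ← Finset.sum_add_distrib]
  refine Finset.sum_congr rfl fun ij hij => ?_
  rw [← mem_antidiagonal.1 hij, add_smul, smul_mul_assoc, mul_smul_comm]

theorem euler_C (a : A) : euler (PowerSeries.C a) = 0 := by
  ext n
  rw [coeff_euler, PowerSeries.coeff_C]
  split_ifs with h <;> simp [h]

/-- As `θ` has no constant term, the equation expresses `n X_n` through `X_i` with `i < n`. -/
theorem eq_of_euler_eq_mul (hA : ∀ (n : ℕ) (x y : A), n ≠ 0 → n • x = n • y → x = y)
    {X Y θ : PowerSeries A} (hθ : PowerSeries.coeff 0 θ = 0) (hX : euler X = X * θ)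
    (hY : euler Y = Y * θ) (h0 : PowerSeries.coeff 0 X = PowerSeries.coeff 0 Y) : X = Y := by
  ext n
  induction n using Nat.strong_induction_on with
  | _ n ih =>
    rcases eq_or_ne n 0 with rfl | hn
    · exact h0
    apply hA n _ _ hn
    rw [← coeff_euler, ← coeff_euler, hX, hY, PowerSeries.coeff_mul, PowerSeries.coeff_mul]
    refine Finset.sum_congr rfl fun ij hij => ?_
    rw [mem_antidiagonal] at hij
    rcases eq_or_ne ij.2 0 with hj | hj
    · rw [hj, hθ, mul_zero, mul_zero]
    · rw [ih ij.1 (by omega)]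

theorem mul_left_cancel_of_coeff_zero_eq_one {F X Y : PowerSeries A}
    (hF : PowerSeries.coeff 0 F = 1) (h : F * X = F * Y) : X = Y := by
  have hinv : PowerSeries.invOfUnit F 1 * F = 1 :=
    PowerSeries.invOfUnit_mul F 1 (by simpa using hF)
  rw [← one_mul X, ← one_mul Y, ← hinv, mul_assoc, h, mul_assoc]

end Euler

section Rotation

variable {N : Type*} [AddCommMonoid N]

theorem sum_antidiagonal_fst_rotate (G : ℕ → ℕ → ℕ → N) (n : ℕ) :
    ∑ x ∈ antidiagonal n, ∑ y ∈ antidiagonal x.1, G y.1 y.2 x.2 =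
      ∑ x ∈ antidiagonal n, ∑ y ∈ antidiagonal x.1, G y.1 x.2 y.2 := by
  simp only [Finset.sum_sigma']
  refine Finset.sum_nbij' (fun x => ⟨(x.2.1 + x.1.2, x.2.2), (x.2.1, x.1.2)⟩)
    (fun x => ⟨(x.2.1 + x.1.2, x.2.2), (x.2.1, x.1.2)⟩) ?_ ?_ ?_ ?_ ?_
  all_goals
    rintro ⟨⟨a, b⟩, ⟨p, q⟩⟩ h
    simp only [Finset.mem_sigma, mem_antidiagonal] at h ⊢
    try grind

theorem sum_antidiagonal_snd_rotate (G : ℕ → ℕ → ℕ → N) (n : ℕ) :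
    ∑ x ∈ antidiagonal n, ∑ y ∈ antidiagonal x.2, G x.1 y.1 y.2 =
      ∑ x ∈ antidiagonal n, ∑ y ∈ antidiagonal x.2, G y.1 x.1 y.2 := by
  simp only [Finset.sum_sigma']
  refine Finset.sum_nbij' (fun x => ⟨(x.2.1, x.1.1 + x.2.2), (x.1.1, x.2.2)⟩)
    (fun x => ⟨(x.2.1, x.1.1 + x.2.2), (x.1.1, x.2.2)⟩) ?_ ?_ ?_ ?_ ?_
  all_goals
    rintro ⟨⟨a, b⟩, ⟨p, q⟩⟩ h
    simp only [Finset.mem_sigma, mem_antidiagonal] at h ⊢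
    try grind

end Rotation

variable {K : Type w} {R : Type u} [Field K] [CommRing R] [Algebra K R]

/-- The power series `∑ₙ ρ(Θₙ) Tⁿ` attached to a sequence `Θ` of derivations. -/
def derSeries {A : Type*} [Ring A] (ρ : Derivation K R R →+ A) (Θ : ℕ → Derivation K R R) :
    PowerSeries A := PowerSeries.mk fun n => ρ (Θ n)

theorem coeff_derSeries {A : Type*} [Ring A] (ρ : Derivation K R R →+ A)
    (Θ : ℕ → Derivation K R R) (n : ℕ) : PowerSeries.coeff n (derSeries ρ Θ) = ρ (Θ n) :=
  PowerSeries.coeff_mk _ _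

variable (K R) in
/-- Derivations as additive endomorphisms of the ring. -/
def derEnd : Derivation K R R →+ Module.End ℤ R where
  toFun der := (der : R →ₗ[K] R).toAddMonoidHom.toIntLinearMap
  map_zero' := rfl
  map_add' _ _ := rfl

theorem derEnd_apply (der : Derivation K R R) (r : R) : derEnd K R der r = der r := rfl

theorem derEnd_injective : Function.Injective (derEnd K R) := fun _ _ h =>
  Derivation.ext fun r => DFunLike.congr_fun h r

theorem derEnd_lie (a b : Derivation K R R) :
    derEnd K R ⁅a, b⁆ = derEnd K R a * derEnd K R b - derEnd K R b * derEnd K R a :=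
  LinearMap.ext fun r => Derivation.commutator_apply (D1 := a) (D2 := b) r

theorem coeff_commutator_derSeries {A : Type*} [Ring A] {ρ : Derivation K R R →+ A}
    (hρ : ∀ a b, ρ ⁅a, b⁆ = ρ a * ρ b - ρ b * ρ a) (X θ : ℕ → Derivation K R R) (n : ℕ) :
    PowerSeries.coeff n (derSeries ρ X * derSeries ρ θ - derSeries ρ θ * derSeries ρ X) =
      ρ (∑ ij ∈ antidiagonal n, ⁅X ij.1, θ ij.2⁆) := by
  rw [map_sub, PowerSeries.coeff_mul, PowerSeries.coeff_mul, map_sum,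
    ← Finset.Nat.sum_antidiagonal_swap (f := fun ij : ℕ × ℕ =>
      PowerSeries.coeff ij.1 (derSeries ρ θ) * PowerSeries.coeff ij.2 (derSeries ρ X)),
    ← Finset.sum_sub_distrib]
  exact Finset.sum_congr rfl fun ij _ => by simp [hρ, coeff_derSeries]

/-- Coefficientwise the hypothesis is an identity between derivations involving only sums and
brackets, because `derEnd` is injective; any additive map respecting brackets preserves it. -/
theorem euler_derSeries_of_lie {A : Type*} [Ring A] {ρ : Derivation K R R →+ A}
    (hρ : ∀ a b, ρ ⁅a, b⁆ = ρ a * ρ b - ρ b * ρ a) {X θ : ℕ → Derivation K R R}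
    (h : euler (derSeries (derEnd K R) X) =
      derSeries (derEnd K R) X * derSeries (derEnd K R) θ -
        derSeries (derEnd K R) θ * derSeries (derEnd K R) X) :
    euler (derSeries ρ X) = derSeries ρ X * derSeries ρ θ - derSeries ρ θ * derSeries ρ X := by
  ext n
  have hn : n • X n = ∑ ij ∈ antidiagonal n, ⁅X ij.1, θ ij.2⁆ := derEnd_injective <| by
    rw [← coeff_commutator_derSeries derEnd_lie, ← h, coeff_euler, coeff_derSeries, map_nsmul]
  rw [coeff_commutator_derSeries hρ, ← hn, coeff_euler, coeff_derSeries, map_nsmul]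

/-! ### Logarithmic derivatives and conjugates of higher derivations. -/

namespace HigherDer

variable (ψ : HigherDer K R)

/-- The power series `∑ₖ ψ^{(k)} Tᵏ` of additive endomorphisms of `R`. -/
def opSeries : PowerSeries (Module.End ℤ R) :=
  PowerSeries.mk fun k => (AddMonoidHom.mk' (ψ.coeff k) (ψ.coeff_add k)).toIntLinearMap

theorem coeff_opSeries (k : ℕ) (r : R) : PowerSeries.coeff k ψ.opSeries r = ψ.coeff k r := by
  rw [opSeries, PowerSeries.coeff_mk]
  rfl

theorem coeff_zero_opSeries : PowerSeries.coeff 0 ψ.opSeries = 1 :=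
  LinearMap.ext fun r => by rw [coeff_opSeries, coeff_zero]; rfl

theorem coeff_opSeries_mul (X : PowerSeries (Module.End ℤ R)) (n : ℕ) (r : R) :
    PowerSeries.coeff n (ψ.opSeries * X) r =
      ψ.extendCoeff (PowerSeries.mk fun k => PowerSeries.coeff k X r) n := by
  simp only [PowerSeries.coeff_mul, LinearMap.sum_apply, Module.End.mul_apply, extendCoeff,
    PowerSeries.coeff_mk]
  exact Finset.sum_congr rfl fun ij _ => ψ.coeff_opSeries _ _

theorem opSeries_mul (ψ₁ ψ₂ : HigherDer K R) :
    (ψ₁ * ψ₂).opSeries = ψ₁.opSeries * ψ₂.opSeries := by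
  ext n r
  rw [coeff_opSeries, mul_coeff, coeff_opSeries_mul]
  simp [extendCoeff, coeff_opSeries]

/-- `ψ⟦T⟧` fixes the leading coefficient of a series, since `ψ ≡ id` modulo `T`. -/
theorem extend_injective : Function.Injective ψ.extend := by
  rw [injective_iff_map_eq_zero]
  intro f hf
  ext n
  induction n using Nat.strong_induction_on with
  | _ n ih =>
    have h : ψ.extendCoeff f n = 0 := by
      rw [← PowerSeries.coeff_mk n (ψ.extendCoeff f)]
      exact congrArg (PowerSeries.coeff n) hf
    rw [extendCoeff, Finset.sum_eq_single (0, n)] at h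
    · rwa [coeff_zero] at h
    · rintro ⟨i, j⟩ hij hne
      rw [mem_antidiagonal] at hij
      have hj : j < n := by
        rcases Nat.eq_zero_or_pos i with rfl | hi
        · exact absurd (congrArg (Prod.mk 0) (by simpa using hij)) hne
        · dsimp only at hij; omega
      rw [ih j hj]
      simp [coeff]
    · simp

/-- Undoing `ψ⟦T⟧` turns the `ψ`-twisted Leibniz rule of `Q` into the ordinary one, coefficient by
coefficient. -/
theorem exists_derivation_series (Q : R →+ PowerSeries R)
    (hmul : ∀ r s, Q (r * s) = Q r * ψ.toAlgHom s + ψ.toAlgHom r * Q s)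
    (hK : ∀ a, Q (algebraMap K R a) = 0) :
    ∃ θ : ℕ → Derivation K R R, ∀ r, ψ.extend (PowerSeries.mk fun n => θ n r) = Q r := by
  let q : PowerSeries (Module.End ℤ R) :=
    PowerSeries.mk fun n => ((PowerSeries.coeff (R := R) n).toAddMonoidHom.comp Q).toIntLinearMap
  -- The preimage of `Q` under `ψ⟦T⟧` is found by inverting `ψ` as an operator series with constant
  -- term `1`.
  let Y := PowerSeries.invOfUnit ψ.opSeries 1 * q
  have hY : ψ.opSeries * Y = q := by
    rw [← mul_assoc, PowerSeries.mul_invOfUnit, one_mul]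
    simpa using ψ.coeff_zero_opSeries
  let y : R → PowerSeries R := fun r => PowerSeries.mk fun n => PowerSeries.coeff n Y r
  have hy : ∀ r, ψ.extend (y r) = Q r := fun r => by
    ext n
    change PowerSeries.coeff n (PowerSeries.mk (ψ.extendCoeff (y r))) = _
    rw [PowerSeries.coeff_mk, ← coeff_opSeries_mul, hY]
    simp [q]
  have hC : ∀ r, ψ.extend (PowerSeries.C r) = ψ.toAlgHom r := fun r => by
    ext n
    change PowerSeries.coeff n (PowerSeries.mk (ψ.extendCoeff _)) = _
    rw [PowerSeries.coeff_mk, extendCoeff, Finset.sum_eq_single (n, 0)]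
    · simp [coeff]
    · rintro ⟨i, j⟩ hij hne
      have hj : j ≠ 0 := by
        rintro rfl
        simp_all
      simp [PowerSeries.coeff_C, hj, coeff]
    · simp
  have ymul : ∀ r s, y (r * s) = PowerSeries.C r * y s + PowerSeries.C s * y r := fun r s => by
    apply ψ.extend_injective
    rw [map_add, map_mul, map_mul, hC, hC, hy, hy, hy, hmul]
    ring
  have yK : ∀ a, y (algebraMap K R a) = 0 := fun a => by
    apply ψ.extend_injective
    rw [hy, hK, map_zero]
  have hcoeff : ∀ n r s, PowerSeries.coeff n Y (r * s) =
      r * PowerSeries.coeff n Y s + s * PowerSeries.coeff n Y r := fun n r s => by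
    simpa [y] using congrArg (PowerSeries.coeff n) (ymul r s)
  have hconst : ∀ n a, PowerSeries.coeff n Y (algebraMap K R a) = 0 := fun n a => by
    simpa [y] using congrArg (PowerSeries.coeff n) (yK a)
  exact ⟨fun n => Derivation.mk'
    { toFun := fun r => PowerSeries.coeff n Y r
      map_add' := map_add (PowerSeries.coeff n Y)
      map_smul' := fun a r => by
        simp [Algebra.smul_def, hcoeff, hconst] }
    (fun r s => hcoeff n r s), hy⟩

theorem exists_derSeries_eq (q : PowerSeries (Module.End ℤ R))
    (hmul : ∀ n r s, PowerSeries.coeff n q (r * s) = ∑ ij ∈ antidiagonal n,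
      (PowerSeries.coeff ij.1 q r * ψ.coeff ij.2 s + ψ.coeff ij.1 r * PowerSeries.coeff ij.2 q s))
    (hK : ∀ n a, PowerSeries.coeff n q (algebraMap K R a) = 0) :
    ∃ θ : ℕ → Derivation K R R, ψ.opSeries * derSeries (derEnd K R) θ = q := by
  obtain ⟨θ, hθ⟩ := ψ.exists_derivation_series
    (AddMonoidHom.mk' (fun r => PowerSeries.mk fun n => PowerSeries.coeff n q r)
      (fun r s => by ext n; simp))
    (fun r s => by
      ext n
      simp [PowerSeries.coeff_mul, hmul, Finset.sum_add_distrib, coeff])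
    (fun a => by ext n; simp [hK])
  refine ⟨θ, ?_⟩
  ext n r
  rw [coeff_opSeries_mul]
  simpa [coeff_derSeries, derEnd_apply, extend] using congrArg (PowerSeries.coeff n) (hθ r)

/-- The logarithmic derivative of a higher derivation consists of derivations. -/
theorem exists_euler_opSeries :
    ∃ θ : ℕ → Derivation K R R, euler ψ.opSeries = ψ.opSeries * derSeries (derEnd K R) θ := by
  obtain ⟨θ, hθ⟩ := ψ.exists_derSeries_eq (euler ψ.opSeries)
    (fun n r s => by
      rw [coeff_euler]
      change n • PowerSeries.coeff n ψ.opSeries (r * s) = _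
      rw [coeff_opSeries, coeff_mul, Finset.smul_sum]
      refine Finset.sum_congr rfl fun ij hij => ?_
      rw [coeff_euler, coeff_euler]
      change _ = ij.1 • PowerSeries.coeff ij.1 ψ.opSeries r * _ +
        _ * ij.2 • PowerSeries.coeff ij.2 ψ.opSeries s
      rw [coeff_opSeries, coeff_opSeries, smul_mul_assoc, mul_smul_comm, ← add_smul,
        mem_antidiagonal.1 hij])
    (fun n a => by
      rw [coeff_euler]
      change n • PowerSeries.coeff n ψ.opSeries _ = _
      rw [coeff_opSeries, coeff_algebraMap]
      split_ifs with h <;> simp [h])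
  exact ⟨θ, hθ.symm⟩

/-- The conjugate `ψ⁻¹ ∂ ψ` of a derivation consists of derivations. -/
theorem exists_conj (der : Derivation K R R) :
    ∃ X : ℕ → Derivation K R R,
      PowerSeries.C (derEnd K R der) * ψ.opSeries = ψ.opSeries * derSeries (derEnd K R) X := by
  have h : ∀ n r, PowerSeries.coeff n (PowerSeries.C (derEnd K R der) * ψ.opSeries) r =
      der (ψ.coeff n r) := fun n r => by
    rw [PowerSeries.coeff_C_mul, ← coeff_opSeries]
    rfl
  obtain ⟨θ, hθ⟩ := ψ.exists_derSeries_eq (PowerSeries.C (derEnd K R der) * ψ.opSeries)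
    (fun n r s => by
      simp only [h, coeff_mul, map_sum, Derivation.leibniz, smul_eq_mul]
      exact Finset.sum_congr rfl fun ij _ => by ring)
    (fun n a => by
      rw [h, coeff_algebraMap]
      split_ifs <;> simp)
  exact ⟨θ, hθ.symm⟩

/-- Applying the Euler operator to `∂Ψ = ΨX` gives `ΨXθ = ΨθX + ΨX'`; then `Ψ` cancels. -/
theorem euler_conj {X θ : ℕ → Derivation K R R} {der : Derivation K R R}
    (hθ : euler ψ.opSeries = ψ.opSeries * derSeries (derEnd K R) θ)
    (hX : PowerSeries.C (derEnd K R der) * ψ.opSeries =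
      ψ.opSeries * derSeries (derEnd K R) X) :
    euler (derSeries (derEnd K R) X) =
      derSeries (derEnd K R) X * derSeries (derEnd K R) θ -
        derSeries (derEnd K R) θ * derSeries (derEnd K R) X := by
  apply mul_left_cancel_of_coeff_zero_eq_one ψ.coeff_zero_opSeries
  have h := congrArg euler hX
  rw [euler_mul, euler_mul, euler_C, hθ, zero_mul, zero_add, ← mul_assoc, hX] at h
  rw [mul_sub, ← mul_assoc, h, ← mul_assoc]
  abel

end HigherDer

end IterConn

end

/-! ### The differential equation for `∇_ψ` and its consequences. -/

noncomputable section

namespace IterConn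

variable {K : Type w} {R : Type u} [Field K] [CommRing R] [Algebra K R]
variable {M : Type v} [AddCommGroup M] [Module R M]

variable (M) in
/-- The contraction `Ω_{R/K} ⊗ M → M` with a derivation. -/
def contract (der : Derivation K R R) : Ω[R⁄K] ⊗[R] M →ₗ[R] M :=
  (TensorProduct.lid R M).toLinearMap ∘ₗ der.liftKaehlerDifferential.rTensor M

theorem contract_tmul (der : Derivation K R R) (ω : Ω[R⁄K]) (m : M) :
    contract M der (ω ⊗ₜ[R] m) = der.liftKaehlerDifferential ω • m := rfl

theorem contract_add (a b : Derivation K R R) (z : Ω[R⁄K] ⊗[R] M) :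
    contract M (a + b) z = contract M a z + contract M b z := by
  have h : (a + b).liftKaehlerDifferential =
      a.liftKaehlerDifferential + b.liftKaehlerDifferential := by
    apply Derivation.liftKaehlerDifferential_unique
    ext r
    simp
  rw [contract, h, LinearMap.rTensor_add, LinearMap.comp_add]
  rfl

theorem tensor_kaehler_induction {p : Ω[R⁄K] ⊗[R] M → Prop}
    (hD : ∀ r m, p (KaehlerDifferential.D K R r ⊗ₜ[R] m)) (hzero : p 0)
    (hadd : ∀ x y, p x → p y → p (x + y)) (z : Ω[R⁄K] ⊗[R] M) : p z := by
  induction z with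
  | zero => exact hzero
  | add x y hx hy => exact hadd x y hx hy
  | tmul ω m =>
    have hω : ω ∈ Submodule.span R (Set.range (KaehlerDifferential.D K R)) := by
      rw [KaehlerDifferential.span_range_derivation]
      trivial
    induction hω using Submodule.span_induction generalizing m with
    | mem y hy =>
      obtain ⟨r, rfl⟩ := hy
      exact hD r m
    | zero => rwa [TensorProduct.zero_tmul]
    | add y z _ _ hy hz => rw [TensorProduct.add_tmul]; exact hadd _ _ (hy m) (hz m)
    | smul r y _ hy => rw [TensorProduct.smul_tmul]; exact hy (r • m)

/-- The covariant derivatives `∂ ↦ ∇_∂` of a connection. -/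
def Connection.alongHom (c : Connection K R M) : Derivation K R R →+ Module.End ℤ M :=
  AddMonoidHom.mk' (fun der => (c.along der).toIntLinearMap) fun a b =>
    LinearMap.ext fun m => contract_add a b (c.toFun m)

theorem Connection.alongHom_apply (c : Connection K R M) (der : Derivation K R R) (m : M) :
    c.alongHom der m = c.along der m := rfl

theorem Connection.Integrable.alongHom_lie {c : Connection K R M} (hc : c.Integrable)
    (a b : Derivation K R R) :
    c.alongHom ⁅a, b⁆ = c.alongHom a * c.alongHom b - c.alongHom b * c.alongHom a :=
  LinearMap.ext fun m => hc a b m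

theorem end_nsmul_injective (K : Type*) (R : Type*) [Field K] [CharZero K] [CommRing R]
    [Algebra K R] {M : Type*} [AddCommGroup M] [Module R M] (n : ℕ) (x y : Module.End ℤ M) (hn : n ≠ 0)
    (h : n • x = n • y) : x = y :=
  LinearMap.ext fun m => nsmul_right_injective_of_algebra K (R := R) hn (LinearMap.congr_fun h m)

namespace HigherDer

variable (ψ : HigherDer K R)

variable (M) in
/-- The coefficient of `Tᵏ` of `ψ̃ ⊗ id : Dif_{R/K} ⊗ M → M⟦T⟧`. -/
def tildeTensor (k : ℕ) : DifGr K R ⊗[R] M →ₗ[R] M :=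
  (TensorProduct.lid R M).toLinearMap ∘ₗ
    ((PowerSeries.coeff k) ∘ₗ ψ.tilde.toLinearMap).rTensor M

theorem tildeTensor_tmul (k : ℕ) (ω : DifGr K R) (m : M) :
    ψ.tildeTensor M k (ω ⊗ₜ[R] m) = PowerSeries.coeff k (ψ.tilde ω) • m := rfl

theorem tildeTensor_d_smul (a b : ℕ) (r : R) (z : DifGr K R ⊗[R] M) :
    ψ.tildeTensor M (a + b) (DifGr.d K R a r • z) = ψ.coeff a r • ψ.tildeTensor M b z := by
  induction z with
  | zero => simp
  | add x y hx hy => simp only [smul_add, map_add, hx, hy]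
  | tmul ω m =>
    have h : PowerSeries.monomial a (ψ.coeff a r) =
        PowerSeries.C (ψ.coeff a r) * PowerSeries.X ^ a := by
      rw [PowerSeries.X_pow_eq, ← PowerSeries.monomial_zero_eq_C_apply,
        PowerSeries.monomial_mul_monomial, zero_add, mul_one]
    rw [TensorProduct.smul_tmul', tildeTensor_tmul, tildeTensor_tmul, smul_smul, smul_eq_mul,
      map_mul, tilde_d, h, mul_assoc, PowerSeries.coeff_C_mul, add_comm,
      PowerSeries.coeff_X_pow_mul]

end HigherDer

namespace HigherConnection

variable (c : HigherConnection K R M) (ψ : HigherDer K R)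

theorem along_apply (k : ℕ) (m : M) : c.along ψ k m = ψ.tildeTensor M k (c.coeff k m) := rfl

theorem along_zero (m : M) : c.along ψ 0 m = m := by
  rw [along_apply, coeff_zero, HigherDer.tildeTensor_tmul, map_one]
  simp

theorem along_smul (r : R) (m : M) (k : ℕ) :
    c.along ψ k (r • m) = ∑ ij ∈ antidiagonal k, ψ.coeff ij.1 r • c.along ψ ij.2 m := by
  rw [along_apply, coeff_smul, map_sum]
  refine Finset.sum_congr rfl fun ij hij => ?_
  rw [← mem_antidiagonal.1 hij, HigherDer.tildeTensor_d_smul, along_apply]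

/-- The rule `∇_ψ⟦T⟧(g m) = ψ⟦T⟧(g) ∇_ψ(m)` for a power series `g`, read off at `Tⁿ`. -/
theorem sum_along_smul (g : PowerSeries R) (m : M) (n : ℕ) :
    ∑ ij ∈ antidiagonal n, c.along ψ ij.1 (PowerSeries.coeff ij.2 g • m) =
      ∑ ij ∈ antidiagonal n, ψ.extendCoeff g ij.1 • c.along ψ ij.2 m := by
  simp only [along_smul, HigherDer.extendCoeff, Finset.sum_smul]
  exact (sum_antidiagonal_fst_rotate
    (fun i j k => ψ.coeff i (PowerSeries.coeff j g) • c.along ψ k m) n).symm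

/-- The power series `∑ₖ ∇_ψ^{(k)} Tᵏ` of additive endomorphisms of `M`. -/
def alongSeries : PowerSeries (Module.End ℤ M) :=
  PowerSeries.mk fun k => (c.along ψ k).toIntLinearMap

theorem coeff_alongSeries (k : ℕ) (m : M) :
    PowerSeries.coeff k (c.alongSeries ψ) m = c.along ψ k m := by
  rw [alongSeries, PowerSeries.coeff_mk]
  rfl

theorem coeff_zero_alongSeries : PowerSeries.coeff 0 (c.alongSeries ψ) = 1 :=
  LinearMap.ext fun m => by rw [coeff_alongSeries, along_zero]; rfl

variable {ψ} {θ : ℕ → Derivation K R R}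

theorem _root_.IterConn.HigherDer.sum_coeff_derivation
    (hθ : euler ψ.opSeries = ψ.opSeries * derSeries (derEnd K R) θ) (n : ℕ) (r : R) :
    ψ.extendCoeff (PowerSeries.mk fun k => θ k r) n = n • ψ.coeff n r := by
  have h := LinearMap.congr_fun (congrArg (PowerSeries.coeff n) hθ) r
  rw [HigherDer.coeff_opSeries_mul, coeff_euler, LinearMap.smul_apply,
    HigherDer.coeff_opSeries] at h
  simpa [coeff_derSeries, derEnd_apply] using h.symm

theorem _root_.IterConn.HigherDer.derivation_zero
    (hθ : euler ψ.opSeries = ψ.opSeries * derSeries (derEnd K R) θ) : θ 0 = 0 := by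
  ext r
  simpa [HigherDer.extendCoeff, HigherDer.coeff_zero] using
    HigherDer.sum_coeff_derivation hθ 0 r

variable {c}

/-- By additivity `z = dr ⊗ m` suffices. Both sides are then `∑ i ψ^{(i)}(r) ∇_ψ^{(j)}(m)`: on the
left because `d_Dif^{(a)} d^{(1)} r = (a+1) d^{(a+1)} r`, on the right by the equation `Ψ' = Ψθ`. -/
theorem tildeTensor_extend
    (hθ : euler ψ.opSeries = ψ.opSeries * derSeries (derEnd K R) θ) (n : ℕ)
    (z : Ω[R⁄K] ⊗[R] M) :
    ψ.tildeTensor M (n + 1) (c.extend n (ofKaehlerTensor K R M z)) =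
      ∑ ij ∈ antidiagonal (n + 1), c.along ψ ij.1 (contract M (θ ij.2) z) := by
  induction z using tensor_kaehler_induction with
  | hzero => simp
  | hadd x y hx hy => simp only [map_add, hx, hy, Finset.sum_add_distrib]
  | hD r m =>
    have h := c.sum_along_smul ψ (PowerSeries.mk fun k => θ k r) m (n + 1)
    simp only [PowerSeries.coeff_mk, HigherDer.sum_coeff_derivation hθ] at h
    simp only [contract_tmul, Derivation.liftKaehlerDifferential_comp_D, h]
    rw [Finset.Nat.sum_antidiagonal_succ, zero_smul, zero_smul, zero_add]
    have h1 : ofKaehlerTensor K R M (KaehlerDifferential.D K R r ⊗ₜ[R] m) =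
        DifGr.d K R 1 r ⊗ₜ[R] m := by
      simp [ofKaehlerTensor, DifGr.dOne_apply]
    rw [h1, extend_tmul, map_sum]
    refine Finset.sum_congr rfl fun ab hab => ?_
    rw [DifGr.dDifComp_d, add_comm 1, Nat.choose_succ_self_right, ← nsmul_eq_mul, smul_assoc,
      map_nsmul, ← mem_antidiagonal.1 hab, add_right_comm, HigherDer.tildeTensor_d_smul,
      along_apply, smul_assoc]

/-- The differential equation satisfied by `∇_ψ`: its logarithmic derivative is the covariant
derivative along the logarithmic derivative of `ψ`. -/
theorem Iterative.euler_alongSeries (hc : c.Iterative)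
    (hθ : euler ψ.opSeries = ψ.opSeries * derSeries (derEnd K R) θ) :
    euler (c.alongSeries ψ) = c.alongSeries ψ * derSeries c.firstOrder.alongHom θ := by
  ext n m
  rw [coeff_euler, LinearMap.smul_apply, coeff_alongSeries, PowerSeries.coeff_mul,
    LinearMap.sum_apply]
  simp only [Module.End.mul_apply, coeff_alongSeries, coeff_derSeries]
  rcases n with _ | n
  · simp [HigherDer.derivation_zero hθ]
  · rw [along_apply, ← map_nsmul, ← hc.extend_coeff_one, coeff_one, tildeTensor_extend hθ]
    rfl

/-- Both sides solve `F' = F ∇_θ` with constant term `∇_∂`. For the right side, integrability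
transports `X' = Xθ - θX` from `Der(R/K)` to `End M`. -/
theorem Iterative.C_mul_alongSeries [CharZero K] (hc : c.Iterative)
    (hint : c.firstOrder.Integrable)
    (hθ : euler ψ.opSeries = ψ.opSeries * derSeries (derEnd K R) θ)
    {X : ℕ → Derivation K R R} {der : Derivation K R R}
    (hX : PowerSeries.C (derEnd K R der) * ψ.opSeries =
      ψ.opSeries * derSeries (derEnd K R) X) :
    PowerSeries.C (c.firstOrder.alongHom der) * c.alongSeries ψ =
      c.alongSeries ψ * derSeries c.firstOrder.alongHom X := by
  have hX0 : X 0 = der := by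
    have h := congrArg (PowerSeries.coeff 0) hX
    simp only [PowerSeries.coeff_zero_C, PowerSeries.coeff_mul, Finset.Nat.antidiagonal_zero,
      Finset.sum_singleton, HigherDer.coeff_zero_opSeries, mul_one, one_mul,
      coeff_derSeries] at h
    exact (derEnd_injective h).symm
  refine eq_of_euler_eq_mul (end_nsmul_injective K R)
    (θ := derSeries c.firstOrder.alongHom θ) ?_ ?_ ?_ ?_
  · rw [coeff_derSeries, HigherDer.derivation_zero hθ, map_zero]
  · rw [euler_mul, euler_C, zero_mul, zero_add, hc.euler_alongSeries hθ, mul_assoc]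
  · rw [euler_mul, hc.euler_alongSeries hθ,
      euler_derSeries_of_lie hint.alongHom_lie (ψ.euler_conj hθ hX), mul_sub, mul_assoc,
      mul_assoc, add_sub_cancel]
  · simp [PowerSeries.coeff_mul, coeff_zero_alongSeries, coeff_derSeries, hX0]

theorem derSeries_mul_of_conj {A : Type*} [Ring A] {ρ : Derivation K R R →+ A}
    {F : PowerSeries A} (Θ : ℕ → Derivation K R R) (X : ℕ → ℕ → Derivation K R R)
    (h : ∀ n, PowerSeries.C (ρ (Θ n)) * F = F * derSeries ρ (X n)) :
    derSeries ρ Θ * F =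
      F * derSeries ρ fun n => ∑ ij ∈ antidiagonal n, X ij.1 ij.2 := by
  ext n
  have h' : ∀ i j, ρ (Θ i) * PowerSeries.coeff j F =
      ∑ pq ∈ antidiagonal j, PowerSeries.coeff pq.1 F * ρ (X i pq.2) := fun i j => by
    rw [← PowerSeries.coeff_C_mul, h, PowerSeries.coeff_mul]
    simp only [coeff_derSeries]
  simp only [PowerSeries.coeff_mul, coeff_derSeries, h', map_sum, Finset.mul_sum]
  exact sum_antidiagonal_snd_rotate (fun i p q => PowerSeries.coeff p F * ρ (X i q)) n

theorem derSeries_add {A : Type*} [Ring A] (ρ : Derivation K R R →+ A)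
    (X Y : ℕ → Derivation K R R) : derSeries ρ (X + Y) = derSeries ρ X + derSeries ρ Y := by
  ext n
  simp [coeff_derSeries]

theorem Iterative.integrable_of_firstOrder [CharZero K] (hc : c.Iterative)
    (hint : c.firstOrder.Integrable) : c.Integrable := by
  intro ψ₁ ψ₂ k m
  obtain ⟨θ₁, h₁⟩ := ψ₁.exists_euler_opSeries
  obtain ⟨θ₂, h₂⟩ := ψ₂.exists_euler_opSeries
  choose X hX using fun n => ψ₂.exists_conj (θ₁ n)
  -- `Y` is the conjugate `ψ₂⁻¹ θ₁ ψ₂` of the whole series `θ₁`; each coefficient contributes its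
  -- own conjugate, shifted by its degree.
  let Y : ℕ → Derivation K R R := fun n => ∑ ij ∈ antidiagonal n, X ij.1 ij.2
  have h₁₂ : euler (ψ₁ * ψ₂).opSeries =
      (ψ₁ * ψ₂).opSeries * derSeries (derEnd K R) (Y + θ₂) := by
    rw [derSeries_add, HigherDer.opSeries_mul, euler_mul, h₁, h₂, mul_assoc ψ₁.opSeries,
      derSeries_mul_of_conj θ₁ X hX, mul_add, mul_assoc, mul_assoc]
  have key : c.alongSeries (ψ₁ * ψ₂) = c.alongSeries ψ₁ * c.alongSeries ψ₂ := by
    refine eq_of_euler_eq_mul (end_nsmul_injective K R) ?_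
      (hc.euler_alongSeries h₁₂) ?_ ?_
    · rw [coeff_derSeries, HigherDer.derivation_zero h₁₂, map_zero]
    · rw [derSeries_add, euler_mul, hc.euler_alongSeries h₁, hc.euler_alongSeries h₂,
        mul_assoc (c.alongSeries ψ₁),
        derSeries_mul_of_conj θ₁ X fun n => hc.C_mul_alongSeries hint h₂ (hX n), mul_add,
        mul_assoc, mul_assoc]
    · simp [PowerSeries.coeff_mul, coeff_zero_alongSeries]
  have h := LinearMap.congr_fun (congrArg (PowerSeries.coeff k) key) m
  rw [coeff_alongSeries, PowerSeries.coeff_mul, LinearMap.sum_apply] at h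
  simpa only [Module.End.mul_apply, coeff_alongSeries] using h

theorem Iterative.along_one (hc : c.Iterative) {der : Derivation K R R}
    (hψ : ∀ r, ψ.coeff 1 r = der r) (m : M) : c.along ψ 1 m = c.firstOrder.along der m := by
  obtain ⟨θ, hθ⟩ := ψ.exists_euler_opSeries
  have h0 := HigherDer.derivation_zero hθ
  have h1 : θ 1 = der := by
    ext r
    simpa [HigherDer.extendCoeff, Finset.Nat.antidiagonal_succ, h0, HigherDer.coeff_zero, hψ]
      using HigherDer.sum_coeff_derivation hθ 1 r
  have h := LinearMap.congr_fun (congrArg (PowerSeries.coeff 1) (hc.euler_alongSeries hθ)) m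
  simpa [coeff_euler, PowerSeries.coeff_mul, Finset.Nat.antidiagonal_succ, coeff_alongSeries,
    coeff_zero_alongSeries, coeff_derSeries, h0, h1, Connection.alongHom_apply] using h

/-- The coefficient of `T²` in `F' = F ∇_θ` is `∇_{θ_1}² + ∇_{θ_2}`; the hypotheses say that `θ_1 =
der` and `θ_2 = der'`. -/
theorem Iterative.two_nsmul_along_two (hc : c.Iterative) {der der' : Derivation K R R}
    (hψ : ∀ r, ψ.coeff 1 r = der r) (hψ' : ∀ r, 2 • ψ.coeff 2 r = der (der r) + der' r) (m : M) :
    2 • c.along ψ 2 m =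
      c.firstOrder.along der (c.firstOrder.along der m) + c.firstOrder.along der' m := by
  obtain ⟨θ, hθ⟩ := ψ.exists_euler_opSeries
  have h0 := HigherDer.derivation_zero hθ
  have h1 : θ 1 = der := by
    ext r
    simpa [HigherDer.extendCoeff, Finset.Nat.antidiagonal_succ, h0, HigherDer.coeff_zero, hψ]
      using HigherDer.sum_coeff_derivation hθ 1 r
  have h2 : θ 2 = der' := by
    ext r
    have := HigherDer.sum_coeff_derivation hθ 2 r
    rw [hψ'] at this
    have hψ0 : ψ.coeff 2 0 = 0 := by simp [HigherDer.coeff]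
    simpa [HigherDer.extendCoeff, Finset.Nat.antidiagonal_succ, h0, h1, HigherDer.coeff_zero, hψ,
      hψ0, add_comm (θ 2 r)] using this
  have h := LinearMap.congr_fun (congrArg (PowerSeries.coeff 2) (hc.euler_alongSeries hθ)) m
  rw [coeff_euler, LinearMap.smul_apply, coeff_alongSeries] at h
  rw [h]
  simp [PowerSeries.coeff_mul, Finset.Nat.antidiagonal_succ, coeff_alongSeries,
    coeff_zero_alongSeries, coeff_derSeries, h0, h1, h2, Connection.alongHom_apply,
    hc.along_one hψ, add_comm]

end HigherConnection

/-! ### Exponentials of derivations and the converse implication. -/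

namespace HigherDer

/-- The divided powers `∂ⁿ / n!` of a derivation. -/
def dividedPower (der : Derivation K R R) : ℕ → R →ₗ[K] R
  | 0 => LinearMap.id
  | n + 1 => ((n + 1 : ℕ) : K)⁻¹ • ((der : R →ₗ[K] R) ∘ₗ dividedPower der n)

theorem derivation_dividedPower [CharZero K] (der : Derivation K R R) (n : ℕ) (r : R) :
    der (dividedPower der n r) = (n + 1) • dividedPower der (n + 1) r := by
  have hn : ((n + 1 : ℕ) : K) ≠ 0 := Nat.cast_ne_zero.2 (Nat.succ_ne_zero n)
  rw [dividedPower, LinearMap.smul_apply, ← Nat.cast_smul_eq_nsmul K, smul_smul,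
    mul_inv_cancel₀ hn, one_smul]
  rfl

theorem dividedPower_mul [CharZero K] (der : Derivation K R R) (n : ℕ) (r s : R) :
    dividedPower der n (r * s) =
      ∑ ij ∈ antidiagonal n, dividedPower der ij.1 r * dividedPower der ij.2 s := by
  induction n with
  | zero => simp [dividedPower]
  | succ n ih =>
    apply nsmul_right_injective_of_algebra K (R := R) (Nat.succ_ne_zero n)
    rw [Nat.succ_eq_add_one, ← derivation_dividedPower, ih, map_sum,
      ← sum_antidiagonal_succ_nsmul (fun a b => dividedPower der a r * dividedPower der b s)]
    refine Finset.sum_congr rfl fun ab _ => ?_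
    rw [Derivation.leibniz, derivation_dividedPower, derivation_dividedPower, smul_eq_mul,
      smul_eq_mul, mul_smul_comm, mul_smul_comm, add_comm, mul_comm (dividedPower der ab.2 s)]

theorem dividedPower_one (der : Derivation K R R) (n : ℕ) :
    dividedPower der n 1 = if n = 0 then 1 else 0 := by
  induction n with
  | zero => rfl
  | succ n ih =>
    rw [dividedPower, LinearMap.smul_apply, LinearMap.comp_apply, ih]
    split_ifs <;> simp_all

variable [CharZero K]

/-- The higher derivation `exp(∂ T)`. -/
def exp (der : Derivation K R R) : HigherDer K R where
  toAlgHom := AlgHom.ofLinearMap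
    { toFun := fun r => PowerSeries.mk fun n => dividedPower der n r
      map_add' := fun r s => by ext n; simp
      map_smul' := fun a r => by ext n; simp }
    (by ext n; simp [dividedPower_one, PowerSeries.coeff_one])
    (fun r s => by ext n; simp [dividedPower_mul, PowerSeries.coeff_mul])
  constantCoeff_apply r := by
    rw [← PowerSeries.coeff_zero_eq_constantCoeff_apply]
    simp [dividedPower]

theorem exp_coeff (der : Derivation K R R) (n : ℕ) (r : R) :
    (exp der).coeff n r = dividedPower der n r := by
  simp [exp, coeff]

theorem exp_coeff_one (der : Derivation K R R) (r : R) : (exp der).coeff 1 r = der r := by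
  simp [exp_coeff, dividedPower]

theorem exp_coeff_two (der : Derivation K R R) (r : R) :
    2 • (exp der).coeff 2 r = der (der r) := by
  rw [exp_coeff, ← derivation_dividedPower der 1, ← exp_coeff, exp_coeff_one]

end HigherDer

namespace HigherConnection

variable {c : HigherConnection K R M}

/-- Twice the `T²`-coefficient of `∇_{exp(aT) exp(bT)}` is `(∇_a + ∇_b)² + ∇_{[a,b]}` by the
differential equation and `∇_a² + 2∇_a∇_b + ∇_b²` by integrability. -/
theorem Iterative.firstOrder_integrable [CharZero K] (hc : c.Iterative)
    (hint : c.Integrable) : c.firstOrder.Integrable := by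
  intro a b m
  have hsum : ∀ (x : M), c.firstOrder.along (a + b) x =
      c.firstOrder.along a x + c.firstOrder.along b x := fun x =>
    contract_add a b (c.firstOrder.toFun x)
  have h0 : ∀ (x : M), c.firstOrder.along (0 : Derivation K R R) x = 0 := fun x =>
    LinearMap.congr_fun (map_zero c.firstOrder.alongHom) x
  have ha := hc.two_nsmul_along_two (der' := 0) (HigherDer.exp_coeff_one a)
    (by simpa using HigherDer.exp_coeff_two a) m
  have hb := hc.two_nsmul_along_two (der' := 0) (HigherDer.exp_coeff_one b)
    (by simpa using HigherDer.exp_coeff_two b) m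
  -- The bracket enters through `a² + 2ab + b² = (a + b)² + [a, b]` on `R`.
  have hab := hc.two_nsmul_along_two (ψ := HigherDer.exp a * HigherDer.exp b) (der := a + b)
    (der' := ⁅a, b⁆)
    (fun r => by
      simp [HigherDer.mul_coeff, Finset.Nat.antidiagonal_succ, HigherDer.coeff_zero,
        HigherDer.exp_coeff_one, add_comm])
    (fun r => by
      simp only [HigherDer.mul_coeff, Finset.Nat.antidiagonal_succ, Finset.sum_cons,
        Finset.map_cons, Finset.Nat.antidiagonal_zero, Finset.map_singleton,
        Finset.sum_singleton, Function.Embedding.prodMap, Function.Embedding.coeFn_mk,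
        Function.Embedding.refl_apply, Prod.map, Nat.succ_eq_add_one, zero_add,
        HigherDer.coeff_zero, HigherDer.exp_coeff_one, smul_add, HigherDer.exp_coeff_two,
        Derivation.commutator_apply, Derivation.add_apply, map_add, Nat.reduceAdd]
      rw [two_nsmul (a (b r))]
      abel)
    m
  rw [hint] at hab
  simp only [Finset.Nat.antidiagonal_succ, Finset.sum_cons, Finset.map_cons,
    Finset.Nat.antidiagonal_zero, Finset.map_singleton, Finset.sum_singleton,
    Function.Embedding.prodMap, Function.Embedding.coeFn_mk, Function.Embedding.refl_apply,
    Prod.map, Nat.succ_eq_add_one, zero_add, Nat.reduceAdd, along_zero, smul_add, ha, hb, h0,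
    add_zero, hc.along_one (HigherDer.exp_coeff_one _), hsum, map_add] at hab
  rw [two_nsmul] at hab
  rw [← sub_eq_zero] at hab ⊢
  rw [← neg_eq_zero, ← hab]
  abel

theorem Iterative.integrable_iff [CharZero K] (hc : c.Iterative) :
    c.Integrable ↔ c.firstOrder.Integrable :=
  ⟨hc.firstOrder_integrable, hc.integrable_of_firstOrder⟩

end HigherConnection

end IterConn

end

theorem mainTheorem5 {K : Type w} {R : Type u} [Field K] [CharZero K] [CommRing R] [IsDomain R]
    [Algebra K R] [Algebra.EssFiniteType K R] [IsRegularRing R]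
    (hR : ∃ m : Ideal R, m.IsMaximal ∧ Module.Finite K (R ⧸ m)) :
    (∀ (M : Type v) [AddCommGroup M] [Module R M] [Module.Finite R M],
      Function.Bijective
        (fun c : {c : IterConn.HigherConnection K R M // c.Iterative} => c.1.firstOrder) ∧
      ∀ c : IterConn.HigherConnection K R M, c.Iterative →
        (c.Integrable ↔ c.firstOrder.Integrable)) ∧
    (IterConn.iconToCon.{w, u, v} K R).IsEquivalence ∧
    ∃ h : ∀ X : IterConn.IConInt.{w, u, v} K R,
        IterConn.isIntegrable K R ((IterConn.iconIntToCon K R).obj X),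
      ((IterConn.isIntegrable K R).lift (IterConn.iconIntToCon K R) h).IsEquivalence :=
  ⟨fun _ _ _ _ => ⟨IterConn.firstOrder_bijective, fun _ hc => hc.integrable_iff⟩,
    IterConn.iconToCon_isEquivalence K R,
    fun X => X.2.1.integrable_iff.1 X.2.2,
    IterConn.iconIntToCon_lift_isEquivalence K R (fun _ _ hc => hc.integrable_iff) _⟩
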